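/- Let $a,b$ be relatively prime integers with $0<a<b$ and let $\beta\in\mathbb C$. On $X=\mathbb C^2$, with sheaf $\mathcal D$ of linear differential operators with holomorphic coefficients, let $$\mathcal M_A(\beta)=\mathcal D/\mathcal D(P,E),\qquad P=\partial_1^{\,b}-\partial_2^{\,a},\quad E=a x_1\partial_1+b x_2\partial_2-\beta ,$$ be the hypergeometric $\mathcal D$-module of $A=(a\ \ b)$. Let $Y=\{x_2=0\}$ and let $p=(\epsilon,0)\in Y$ with $\epsilon\neq 0$; put $t_1=x_1-\epsilon$. A germ at $p$ of the formal completion $\mathcal O_{\widehat{X|Y}}$ of $\mathcal O_X$ along $Y$ is a series $f=\sum_{i\ge 0}f_i(x_1)x_2^i$ whose coefficients $f_i$ are holomorphic on a common neighbourhood of $x_1=\epsilon$. For $1\le s<\infty$, it is a Gevrey series of order $s$ if $\sum_i (i!)^{-(s-1)}f_i(x_1)x_2^i$ converges in a neighbourhood of $p$; for $s=\infty$ there is no further condition. Let $\mathcal O_{\widehat{X|Y}}(s)_p$ be the $\mathcal D_p$-module of these germs and let $\mathcal Q_Y(s)_p=\mathcal O_{\widehat{X|Y}}(s)_p/\mathcal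 O_{X,p}$; the class of $f$ is written $\overline f$. Finally $$\mathcal Ext^0(\mathcal M_A(\beta),\mathcal Q_Y(s))_p=\operatorname{Hom}_{\mathcal D_p}(\mathcal M_A(\beta)_p,\mathcal Q_Y(s)_p),$$ where a homomorphism is identified with the image of the generator $\overline 1$, so that this is a subspace of $\mathcal Q_Y(s)_p$. For $z\in\mathbb C$ and $n\in\mathbb N$ let $(z)_n=z(z-1)\cdots(z-n+1)$, let $(z)_\alpha=(z_1)_{\alpha_1}(z_2)_{\alpha_2}$ for $z\in\mathbb C^2$, $\alpha\in\mathbb N^2$, and for $v\in\mathbb C^2$, $u\in\mathbb Z^2$ with positive and negative parts $u=u_+-u_-$ let $\Gamma[v;u]=(v)_{u_-}/(v+u)_{u_+}$ if the denominator is nonzero, and $\Gamma[v;u]=0$ otherwise. Let $u(m)=(-bm,am)$. Fix any logarithm of $\epsilon$, which determines a branch of the powers $x_1^\gamma=(t_1+\epsilon)^\gamma$ near $p$. For $k=0,\dots,a-1$ let $v^k=(\frac{\beta-kb}{a},k)$ and $$\phi_{v^k,p}=x^{v^k}\sum_{m\ge 0}\Gamma[v^k;u(m)]\,x_1^{-bm}x_2^{am}.$$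 If $\beta\in a\mathbb N+b\mathbb N$, there is a unique $q\in\{0,\dots,a-1\}$ with $\beta=qb+am_0$ for some $m_0\in\mathbb N$; let $m'$ be the smallest integer with $bm'\ge m_0+1$, let $\widetilde{v^q}=v^q+u(m')=(m_0-bm',\,q+am')$ and $$\phi_{\widetilde{v^q},p}=x^{\widetilde{v^q}}\sum_{m\in\mathbb N,\ bm\ge m_0+1}\Gamma[\widetilde{v^q};u(m)]\,x_1^{-bm}x_2^{am}.$$ **Theorem.** For all $a,b,\beta,p$ as above and all $1\le s\le\infty$, $$\dim_{\mathbb C}\mathcal Ext^0(\mathcal M_A(\beta),\mathcal Q_Y(s))_p=\begin{cases}a&\text{if } s\ge b/a,\\ 0&\text{if } s<b/a.\end{cases}$$ Moreover, let $s\ge b/a$. i) If $\beta\notin a\mathbb N+b\mathbb N$, then the classes $\overline{\phi_{v^k,p}}$, $0\le k\le a-1$, form a basis of $\mathcal Ext^0(\mathcal M_A(\beta),\mathcal Q_Y(s))_p$. ii) If $\beta\in a\mathbb N+b\mathbb N$, then the classes $\overline{\phi_{v^k,p}}$, $0\le k\le a-1$, $k\neq q$, together with $\overline{\phi_{\widetilde{v^q},p}}$,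 form a basis of $\mathcal Ext^0(\mathcal M_A(\beta),\mathcal Q_Y(s))_p$. In particular, the series in these bases are Gevrey series of order $s$. -/

import Mathlib

open scoped ENNReal Nat

namespace GKZ

noncomputable section

/-! ### Formal power series at a point of the line `x₂ = 0`

A point of `Y = {x₂ = 0}` is written `p = (ε, 0)`; `t₁ = x₁ - ε` and `x₂` are coordinates centred
at `p`, and germs at `p` are identified with their Taylor series in `(t₁, x₂)`. -/

/-- `ℂ⟦t₁⟧⟦x₂⟧`, the ring of formal power series `f = ∑ i, fᵢ(t₁) x₂ ^ i`. -/
def FormalSeries : Type := PowerSeries (PowerSeries ℂ)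

instance : CommRing FormalSeries := inferInstanceAs (CommRing (PowerSeries (PowerSeries ℂ)))

instance : Algebra ℂ FormalSeries := inferInstanceAs (Algebra ℂ (PowerSeries (PowerSeries ℂ)))

/-- The series `∑ i, F i * x₂ ^ i`. -/
def FormalSeries.mk (F : ℕ → PowerSeries ℂ) : FormalSeries := PowerSeries.mk F

/-- The coefficient `fᵢ(t₁)` of `x₂ ^ i`. -/
def FormalSeries.coeff (i : ℕ) (f : FormalSeries) : PowerSeries ℂ :=
  PowerSeries.coeff (R := PowerSeries ℂ) i f

/-- The coefficient of `x₂ ^ i * t₁ ^ j`. -/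
def cf (f : FormalSeries) (i j : ℕ) : ℂ := PowerSeries.coeff j (f.coeff i)

@[ext]
theorem FormalSeries.ext {f g : FormalSeries} (h : ∀ i j, cf f i j = cf g i j) : f = g :=
  PowerSeries.ext (R := PowerSeries ℂ) fun i => PowerSeries.ext fun j => h i j

theorem cf_mk (F : ℕ → PowerSeries ℂ) (i j : ℕ) :
    cf (FormalSeries.mk F) i j = PowerSeries.coeff j (F i) :=
  congrArg (PowerSeries.coeff j) (PowerSeries.coeff_mk (R := PowerSeries ℂ) i F)

theorem cf_add (f g : FormalSeries) (i j : ℕ) : cf (f + g) i j = cf f i j + cf g i j := by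
  have h : (f + g).coeff i = f.coeff i + g.coeff i :=
    map_add (PowerSeries.coeff (R := PowerSeries ℂ) i) f g
  simp [cf, h]

theorem cf_zero (i j : ℕ) : cf 0 i j = 0 := by
  have h : (0 : FormalSeries).coeff i = 0 := map_zero (PowerSeries.coeff (R := PowerSeries ℂ) i)
  simp [cf, h]

theorem cf_smul (c : ℂ) (f : FormalSeries) (i j : ℕ) : cf (c • f) i j = c * cf f i j := by
  have h : (c • f).coeff i = c • f.coeff i := rfl
  simp [cf, h]

theorem cf_mul (f g : FormalSeries) (i j : ℕ) :
    cf (f * g) i j = ∑ m ∈ Finset.HasAntidiagonal.antidiagonal i,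
      ∑ n ∈ Finset.HasAntidiagonal.antidiagonal j, cf f m.1 n.1 * cf g m.2 n.2 := by
  have h : (f * g).coeff i = ∑ m ∈ Finset.HasAntidiagonal.antidiagonal i,
      f.coeff m.1 * g.coeff m.2 := PowerSeries.coeff_mul (R := PowerSeries ℂ) i f g
  simp [cf, h, PowerSeries.coeff_mul]

/-- `f` converges in a neighbourhood of `(t₁, x₂) = (0, 0)`, that is `f ∈ ℂ{t₁, x₂} = 𝒪_{X,p}`. -/
def IsConvergent (f : FormalSeries) : Prop :=
  ∃ r : ℝ, 0 < r ∧ Summable fun n : ℕ × ℕ => ‖cf f n.1 n.2‖ * r ^ (n.1 + n.2)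

/-- `f = ∑ i, fᵢ(t₁) x₂ ^ i` is a germ at `p` of the formal completion of `𝒪_X` along `Y`:
all the `fᵢ` are holomorphic on a common disc around `t₁ = 0`. -/
def IsFormalGerm (f : FormalSeries) : Prop :=
  ∃ r : ℝ, 0 < r ∧ ∀ i, Summable fun j : ℕ => ‖cf f i j‖ * r ^ j

/-- `ρ_s(f) = ∑ i, (i!) ^ (-(s - 1)) fᵢ(t₁) x₂ ^ i`, for a real number `s`. -/
def rho (s : ℝ) (f : FormalSeries) : FormalSeries :=
  FormalSeries.mk fun i => (((1 / (i ! : ℝ) ^ (s - 1) : ℝ)) : ℂ) • f.coeff i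

/-- Gevrey series of order `s` along `Y` at `p`, for `1 ≤ s ≤ ∞`; for `s = ∞` there is no condition
besides being a germ of the formal completion. -/
def IsGevrey (s : ℝ≥0∞) (f : FormalSeries) : Prop :=
  IsFormalGerm f ∧ (s ≠ ⊤ → IsConvergent (rho s.toReal f))

/-! ### Germs of differential operators -/

/-- `∂₁ = ∂ / ∂t₁ = ∂ / ∂x₁`, acting coefficientwise. -/
def d1 : Module.End ℂ FormalSeries where
  toFun f := FormalSeries.mk fun i => PowerSeries.derivative ℂ (f.coeff i)
  map_add' f g := by
    ext i j
    simp only [cf_add, cf_mk, PowerSeries.coeff_derivative, ← cf.eq_1, add_mul]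
  map_smul' c f := by
    ext i j
    simp only [cf_smul, cf_mk, PowerSeries.coeff_derivative, ← cf.eq_1, RingHom.id_apply, mul_assoc]

/-- `∂₂ = ∂ / ∂x₂`: the coefficient of `x₂ ^ i` in `∂₂ f` is `(i + 1) f_{i + 1}`. -/
def d2 : Module.End ℂ FormalSeries where
  toFun f := FormalSeries.mk fun i => ((i : ℂ) + 1) • f.coeff (i + 1)
  map_add' f g := by
    ext i j
    simp only [cf_add, cf_mk, PowerSeries.coeff_smul, ← cf.eq_1, mul_add, smul_eq_mul]
  map_smul' c f := by
    ext i j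
    simp only [cf_smul, cf_mk, PowerSeries.coeff_smul, ← cf.eq_1, RingHom.id_apply, smul_eq_mul,
      mul_left_comm]

/-- The subalgebra generated by the multiplications by convergent power series and by `∂₁`, `∂₂`. -/
def diffOpAlgebra : Subalgebra ℂ (Module.End ℂ FormalSeries) :=
  Algebra.adjoin ℂ ({d1, d2} ∪ {T | ∃ g, IsConvergent g ∧ T = LinearMap.mulLeft ℂ g})

/-- The ring `𝒟_{X,p}` of germs of linear differential operators with holomorphic coefficients,
realized by its (faithful) action on formal power series at `p`. -/
def DiffOp : Type := diffOpAlgebra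

instance : Ring DiffOp := inferInstanceAs (Ring diffOpAlgebra)

instance : Algebra ℂ DiffOp := inferInstanceAs (Algebra ℂ diffOpAlgebra)

/-- The operator on formal power series underlying `T`. -/
def DiffOp.toEnd : DiffOp →ₐ[ℂ] Module.End ℂ FormalSeries := diffOpAlgebra.val

/-- Formal power series at `p` form a left `𝒟_{X,p}`-module. -/
instance : Module DiffOp FormalSeries := Module.compHom FormalSeries DiffOp.toEnd.toRingHom

theorem DiffOp.smul_def (T : DiffOp) (f : FormalSeries) : T • f = DiffOp.toEnd T f := rfl

instance : IsScalarTower ℂ DiffOp FormalSeries where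
  smul_assoc c T f := by simp [DiffOp.smul_def]

section Stability

theorem cf_d1 (f : FormalSeries) (i j : ℕ) : cf (d1 f) i j = cf f i (j + 1) * (j + 1) := by
  have h : d1 f = FormalSeries.mk fun i => PowerSeries.derivative ℂ (f.coeff i) := rfl
  rw [h, cf_mk, PowerSeries.coeff_derivative]
  rfl

theorem cf_d2 (f : FormalSeries) (i j : ℕ) : cf (d2 f) i j = cf f (i + 1) j * (i + 1) := by
  have h : d2 f = FormalSeries.mk fun i => ((i : ℂ) + 1) • f.coeff (i + 1) := rfl
  rw [h, cf_mk, PowerSeries.coeff_smul, smul_eq_mul, mul_comm]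
  rfl

theorem cf_rho (s : ℝ) (f : FormalSeries) (i j : ℕ) :
    cf (rho s f) i j = ((1 / (i ! : ℝ) ^ (s - 1) : ℝ) : ℂ) * cf f i j := by
  rw [rho, cf_mk, PowerSeries.coeff_smul, smul_eq_mul]
  rfl

theorem rho_one (f : FormalSeries) : rho 1 f = f := by
  ext i j
  simp [cf_rho]

theorem isConvergent_iff (f : FormalSeries) :
    IsConvergent f ↔ ∃ C R : ℝ, 0 ≤ C ∧ 0 < R ∧ ∀ i j, ‖cf f i j‖ ≤ C * R ^ (i + j) := by
  constructor
  · rintro ⟨r, hr, h⟩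
    refine ⟨∑' n : ℕ × ℕ, ‖cf f n.1 n.2‖ * r ^ (n.1 + n.2), r⁻¹,
      tsum_nonneg fun n => by positivity, by positivity, fun i j => ?_⟩
    have := h.le_tsum (i, j) (fun n _ => by positivity)
    rw [inv_pow, ← div_eq_mul_inv, le_div_iff₀ (by positivity)]
    exact this
  · rintro ⟨C, R, hC, hR, h⟩
    refine ⟨(2 * R)⁻¹, by positivity, ?_⟩
    have hs : Summable fun n : ℕ × ℕ => C * ((1 / 2 : ℝ) ^ n.1 * (1 / 2 : ℝ) ^ n.2) :=
      (summable_geometric_two.mul_of_nonneg summable_geometric_two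
        (fun n => by positivity) (fun n => by positivity)).mul_left C
    refine Summable.of_nonneg_of_le (fun n => by positivity) (fun n => ?_) hs
    calc ‖cf f n.1 n.2‖ * (2 * R)⁻¹ ^ (n.1 + n.2)
        ≤ (C * R ^ (n.1 + n.2)) * (2 * R)⁻¹ ^ (n.1 + n.2) := by gcongr; exact h _ _
      _ = C * ((1 / 2 : ℝ) ^ n.1 * (1 / 2 : ℝ) ^ n.2) := by
          rw [← pow_add, mul_assoc, ← mul_pow]
          congr 2
          field_simp

theorem isFormalGerm_iff (f : FormalSeries) :
    IsFormalGerm f ↔ ∃ R : ℝ, 0 < R ∧ ∀ i, ∃ C : ℝ, 0 ≤ C ∧ ∀ j, ‖cf f i j‖ ≤ C * R ^ j := by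
  constructor
  · rintro ⟨r, hr, h⟩
    refine ⟨r⁻¹, by positivity, fun i => ⟨∑' j, ‖cf f i j‖ * r ^ j,
      tsum_nonneg fun n => by positivity, fun j => ?_⟩⟩
    have := (h i).le_tsum j (fun n _ => by positivity)
    rw [inv_pow, ← div_eq_mul_inv, le_div_iff₀ (by positivity)]
    exact this
  · rintro ⟨R, hR, h⟩
    refine ⟨(2 * R)⁻¹, by positivity, fun i => ?_⟩
    obtain ⟨C, hC, h⟩ := h i
    refine Summable.of_nonneg_of_le (fun n => by positivity) (fun n => ?_)
      (summable_geometric_two.mul_left C)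
    calc ‖cf f i n‖ * (2 * R)⁻¹ ^ n
        ≤ (C * R ^ n) * (2 * R)⁻¹ ^ n := by gcongr; exact h _
      _ = C * (1 / 2 : ℝ) ^ n := by
          rw [mul_assoc, ← mul_pow]
          congr 2
          field_simp

theorem isConvergent_rho_iff (s : ℝ) (f : FormalSeries) :
    IsConvergent (rho s f) ↔ ∃ C R : ℝ, 0 ≤ C ∧ 0 < R ∧
      ∀ i j, ‖cf f i j‖ ≤ C * R ^ (i + j) * (i ! : ℝ) ^ (s - 1) := by
  rw [isConvergent_iff]
  have key : ∀ (C R : ℝ) (i j : ℕ), ‖cf (rho s f) i j‖ ≤ C * R ^ (i + j) ↔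
      ‖cf f i j‖ ≤ C * R ^ (i + j) * (i ! : ℝ) ^ (s - 1) := by
    intro C R i j
    have hw : 0 < (i ! : ℝ) ^ (s - 1) := Real.rpow_pos_of_pos (by positivity) _
    rw [cf_rho, norm_mul, Complex.norm_real, Real.norm_of_nonneg (by positivity), one_div,
      inv_mul_le_iff₀ hw, mul_comm ((i ! : ℝ) ^ (s - 1))]
  simp only [key]

theorem isGevrey_one_iff (f : FormalSeries) : IsGevrey 1 f ↔ IsConvergent f := by
  simp only [IsGevrey, ne_eq, ENNReal.one_ne_top, not_false_eq_true, forall_const,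
    ENNReal.toReal_one, rho_one, and_iff_right_iff_imp]
  rw [isConvergent_iff, isFormalGerm_iff]
  rintro ⟨C, R, hC, hR, h⟩
  refine ⟨R, hR, fun i => ⟨C * R ^ i, by positivity, fun j => ?_⟩⟩
  simpa [pow_add, mul_assoc] using h i j

theorem succ_le_two_pow (n : ℕ) : ((n : ℝ) + 1) ≤ 2 ^ n := by
  exact_mod_cast Nat.lt_two_pow_self (n := n)

theorem IsFormalGerm.zero : IsFormalGerm 0 :=
  (isFormalGerm_iff _).2 ⟨1, one_pos, fun i => ⟨0, le_rfl, fun j => by simp [cf_zero]⟩⟩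

theorem IsFormalGerm.add {f g : FormalSeries} (hf : IsFormalGerm f) (hg : IsFormalGerm g) :
    IsFormalGerm (f + g) := by
  rw [isFormalGerm_iff] at *
  obtain ⟨R, hR, hf⟩ := hf
  obtain ⟨S, hS, hg⟩ := hg
  refine ⟨max R S, lt_max_of_lt_left hR, fun i => ?_⟩
  obtain ⟨C, hC, hf⟩ := hf i
  obtain ⟨D, hD, hg⟩ := hg i
  refine ⟨C + D, by positivity, fun j => ?_⟩
  rw [cf_add, add_mul]
  refine (norm_add_le _ _).trans (add_le_add ((hf j).trans ?_) ((hg j).trans ?_))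
  · gcongr; exact le_max_left _ _
  · gcongr; exact le_max_right _ _

theorem IsFormalGerm.smul {f : FormalSeries} (c : ℂ) (hf : IsFormalGerm f) :
    IsFormalGerm (c • f) := by
  rw [isFormalGerm_iff] at *
  obtain ⟨R, hR, hf⟩ := hf
  refine ⟨R, hR, fun i => ?_⟩
  obtain ⟨C, hC, hf⟩ := hf i
  refine ⟨‖c‖ * C, by positivity, fun j => ?_⟩
  rw [cf_smul, norm_mul, mul_assoc]
  gcongr
  exact hf j

theorem IsFormalGerm.d1 {f : FormalSeries} (hf : IsFormalGerm f) : IsFormalGerm (d1 f) := by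
  rw [isFormalGerm_iff] at *
  obtain ⟨R, hR, hf⟩ := hf
  refine ⟨2 * R, by positivity, fun i => ?_⟩
  obtain ⟨C, hC, hf⟩ := hf i
  refine ⟨C * R, by positivity, fun j => ?_⟩
  have h1 : ‖((j : ℂ) + 1)‖ = (j : ℝ) + 1 := by
    rw [← Nat.cast_succ, Complex.norm_natCast]; simp
  rw [cf_d1, norm_mul, h1]
  calc ‖cf f i (j + 1)‖ * ((j : ℝ) + 1) ≤ (C * R ^ (j + 1)) * 2 ^ j :=
        mul_le_mul (hf _) (succ_le_two_pow j) (by positivity) (by positivity)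
    _ = C * R * (2 * R) ^ j := by rw [mul_pow]; ring

theorem IsFormalGerm.d2 {f : FormalSeries} (hf : IsFormalGerm f) : IsFormalGerm (d2 f) := by
  rw [isFormalGerm_iff] at *
  obtain ⟨R, hR, hf⟩ := hf
  refine ⟨R, hR, fun i => ?_⟩
  obtain ⟨C, hC, hf⟩ := hf (i + 1)
  refine ⟨C * ‖((i : ℂ) + 1)‖, by positivity, fun j => ?_⟩
  rw [cf_d2, norm_mul, mul_right_comm]
  gcongr
  exact hf j

theorem IsFormalGerm.mul {g f : FormalSeries} (hg : IsFormalGerm g) (hf : IsFormalGerm f) :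
    IsFormalGerm (g * f) := by
  rw [isFormalGerm_iff] at *
  obtain ⟨R, hR, hg⟩ := hg
  obtain ⟨S, hS, hf⟩ := hf
  choose C hC hg using hg
  choose D hD hf using hf
  have hM : 0 < max R S := lt_max_of_lt_left hR
  refine ⟨2 * max R S, by positivity, fun i =>
    ⟨∑ m ∈ Finset.HasAntidiagonal.antidiagonal i, C m.1 * D m.2,
      Finset.sum_nonneg fun m _ => mul_nonneg (hC _) (hD _), fun j => ?_⟩⟩
  rw [cf_mul, Finset.sum_mul]
  refine (norm_sum_le _ _).trans (Finset.sum_le_sum fun m _ => ?_)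
  refine (norm_sum_le _ _).trans ?_
  have : ∀ n ∈ Finset.HasAntidiagonal.antidiagonal j, ‖cf g m.1 n.1 * cf f m.2 n.2‖
      ≤ C m.1 * D m.2 * (max R S) ^ j := by
    intro n hn
    rw [← Finset.HasAntidiagonal.mem_antidiagonal.1 hn, norm_mul, pow_add]
    calc ‖cf g m.1 n.1‖ * ‖cf f m.2 n.2‖
        ≤ (C m.1 * (max R S) ^ n.1) * (D m.2 * (max R S) ^ n.2) := by
          have h1 := hC m.1
          have h2 := hD m.2
          refine mul_le_mul ((hg _ _).trans ?_) ((hf _ _).trans ?_) (by positivity) (by positivity)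
          · gcongr; exact le_max_left _ _
          · gcongr; exact le_max_right _ _
      _ = _ := by ring
  refine (Finset.sum_le_card_nsmul _ _ _ this).trans ?_
  rw [Finset.Nat.card_antidiagonal, nsmul_eq_mul, mul_pow, Nat.cast_succ]
  have h1 := hC m.1
  have h2 := hD m.2
  calc ((j : ℝ) + 1) * (C m.1 * D m.2 * max R S ^ j)
      ≤ 2 ^ j * (C m.1 * D m.2 * max R S ^ j) := by gcongr; exact succ_le_two_pow j
    _ = _ := by ring

theorem rhoConv_add {s : ℝ} {f g : FormalSeries} (hf : IsConvergent (rho s f))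
    (hg : IsConvergent (rho s g)) : IsConvergent (rho s (f + g)) := by
  rw [isConvergent_rho_iff] at *
  obtain ⟨C, R, hC, hR, hf⟩ := hf
  obtain ⟨D, S, hD, hS, hg⟩ := hg
  refine ⟨C + D, max R S, by positivity, lt_max_of_lt_left hR, fun i j => ?_⟩
  rw [cf_add, add_mul, add_mul]
  refine (norm_add_le _ _).trans (add_le_add ((hf i j).trans ?_) ((hg i j).trans ?_))
  · gcongr; exact le_max_left _ _
  · gcongr; exact le_max_right _ _

theorem rhoConv_smul {s : ℝ} {f : FormalSeries} (c : ℂ) (hf : IsConvergent (rho s f)) :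
    IsConvergent (rho s (c • f)) := by
  rw [isConvergent_rho_iff] at *
  obtain ⟨C, R, hC, hR, hf⟩ := hf
  refine ⟨‖c‖ * C, R, by positivity, hR, fun i j => ?_⟩
  rw [cf_smul, norm_mul, mul_assoc, mul_assoc, ← mul_assoc C]
  gcongr
  exact hf i j

theorem rhoConv_d1 {s : ℝ} {f : FormalSeries} (hf : IsConvergent (rho s f)) :
    IsConvergent (rho s (d1 f)) := by
  rw [isConvergent_rho_iff] at *
  obtain ⟨C, R, hC, hR, hf⟩ := hf
  refine ⟨C * R, 2 * R, by positivity, by positivity, fun i j => ?_⟩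
  have h1 : ‖((j : ℂ) + 1)‖ = (j : ℝ) + 1 := by
    rw [← Nat.cast_succ, Complex.norm_natCast]; simp
  have h2 : ((j : ℝ) + 1) ≤ 2 ^ (i + j) :=
    (succ_le_two_pow j).trans (pow_le_pow_right₀ (by norm_num) (by omega))
  rw [cf_d1, norm_mul, h1]
  calc ‖cf f i (j + 1)‖ * ((j : ℝ) + 1)
      ≤ (C * R ^ (i + (j + 1)) * (i ! : ℝ) ^ (s - 1)) * 2 ^ (i + j) :=
        mul_le_mul (hf _ _) h2 (by positivity) (by positivity)
    _ = C * R * (2 * R) ^ (i + j) * (i ! : ℝ) ^ (s - 1) := by rw [mul_pow]; ring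

theorem rhoConv_d2 {s : ℝ} (hs : 1 ≤ s) {f : FormalSeries} (hf : IsConvergent (rho s f)) :
    IsConvergent (rho s (d2 f)) := by
  rw [isConvergent_rho_iff] at *
  obtain ⟨C, R, hC, hR, hf⟩ := hf
  have hK : (1 : ℝ) ≤ (2 : ℝ) ^ s := Real.one_le_rpow (by norm_num) (by linarith)
  refine ⟨C * R, 2 ^ s * R, by positivity, by positivity, fun i j => ?_⟩
  have h1 : ‖((i : ℂ) + 1)‖ = (i : ℝ) + 1 := by
    rw [← Nat.cast_succ, Complex.norm_natCast]; simp
  have h2 : ((i + 1) ! : ℝ) ^ (s - 1) * ((i : ℝ) + 1)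
      = (i ! : ℝ) ^ (s - 1) * ((i : ℝ) + 1) ^ s := by
    rw [Nat.factorial_succ, Nat.cast_mul, Nat.cast_succ,
      Real.mul_rpow (by positivity) (by positivity), Real.rpow_sub_one (by positivity : (i : ℝ) + 1 ≠ 0)]
    field_simp
  have h3 : ((i : ℝ) + 1) ^ s ≤ ((2 : ℝ) ^ s) ^ (i + j) := by
    calc ((i : ℝ) + 1) ^ s ≤ ((2 : ℝ) ^ i) ^ s :=
          Real.rpow_le_rpow (by positivity) (succ_le_two_pow i) (by linarith)
      _ = ((2 : ℝ) ^ s) ^ i := by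
          rw [← Real.rpow_natCast, ← Real.rpow_natCast, ← Real.rpow_mul (by norm_num),
            ← Real.rpow_mul (by norm_num), mul_comm]
      _ ≤ _ := pow_le_pow_right₀ hK (by omega)
  rw [cf_d2, norm_mul, h1]
  calc ‖cf f (i + 1) j‖ * ((i : ℝ) + 1)
      ≤ (C * R ^ (i + 1 + j) * ((i + 1) ! : ℝ) ^ (s - 1)) * ((i : ℝ) + 1) := by
        gcongr; exact hf _ _
    _ = C * R ^ (i + 1 + j) * ((i ! : ℝ) ^ (s - 1) * ((i : ℝ) + 1) ^ s) := by
        rw [mul_assoc, h2]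
    _ ≤ C * R ^ (i + 1 + j) * ((i ! : ℝ) ^ (s - 1) * ((2 : ℝ) ^ s) ^ (i + j)) := by gcongr
    _ = _ := by rw [mul_pow]; ring

theorem rhoConv_mul {s : ℝ} (hs : 1 ≤ s) {g f : FormalSeries} (hg : IsConvergent g)
    (hf : IsConvergent (rho s f)) : IsConvergent (rho s (g * f)) := by
  rw [isConvergent_rho_iff] at *
  rw [isConvergent_iff] at hg
  obtain ⟨C, R, hC, hR, hg⟩ := hg
  obtain ⟨D, S, hD, hS, hf⟩ := hf
  have hM : 0 < max R S := lt_max_of_lt_left hR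
  refine ⟨C * D, 2 * max R S, by positivity, by positivity, fun i j => ?_⟩
  have hw : ∀ m ≤ i, (m ! : ℝ) ^ (s - 1) ≤ (i ! : ℝ) ^ (s - 1) := fun m hm =>
    Real.rpow_le_rpow (by positivity) (by exact_mod_cast Nat.factorial_le hm) (by linarith)
  have key : ∀ m ∈ Finset.HasAntidiagonal.antidiagonal i, ∀ n ∈ Finset.HasAntidiagonal.antidiagonal j,
      ‖cf g m.1 n.1 * cf f m.2 n.2‖ ≤ C * D * (max R S) ^ (i + j) * (i ! : ℝ) ^ (s - 1) := by
    intro m hm n hn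
    have hm' := Finset.HasAntidiagonal.mem_antidiagonal.1 hm
    have hn' := Finset.HasAntidiagonal.mem_antidiagonal.1 hn
    rw [norm_mul]
    calc ‖cf g m.1 n.1‖ * ‖cf f m.2 n.2‖
        ≤ (C * (max R S) ^ (m.1 + n.1)) *
            (D * (max R S) ^ (m.2 + n.2) * (i ! : ℝ) ^ (s - 1)) := by
          refine mul_le_mul ((hg _ _).trans ?_) ((hf _ _).trans ?_) (by positivity) (by positivity)
          · gcongr; exact le_max_left _ _
          · gcongr
            · exact le_max_right _ _
            · omega
      _ = C * D * (max R S) ^ ((m.1 + n.1) + (m.2 + n.2)) * (i ! : ℝ) ^ (s - 1) := by ring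
      _ = _ := by congr 3; omega
  rw [cf_mul]
  refine (norm_sum_le _ _).trans ?_
  have h1 : ∀ m ∈ Finset.HasAntidiagonal.antidiagonal i, ‖∑ n ∈ Finset.HasAntidiagonal.antidiagonal j,
      cf g m.1 n.1 * cf f m.2 n.2‖
      ≤ 2 ^ j * (C * D * (max R S) ^ (i + j) * (i ! : ℝ) ^ (s - 1)) := by
    intro m hm
    refine (norm_sum_le _ _).trans ((Finset.sum_le_card_nsmul _ _ _ (key m hm)).trans ?_)
    rw [Finset.Nat.card_antidiagonal, nsmul_eq_mul, Nat.cast_succ]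
    gcongr
    exact succ_le_two_pow j
  refine (Finset.sum_le_card_nsmul _ _ _ h1).trans ?_
  rw [Finset.Nat.card_antidiagonal, nsmul_eq_mul, Nat.cast_succ]
  calc ((i : ℝ) + 1) * (2 ^ j * (C * D * (max R S) ^ (i + j) * (i ! : ℝ) ^ (s - 1)))
      ≤ 2 ^ i * (2 ^ j * (C * D * (max R S) ^ (i + j) * (i ! : ℝ) ^ (s - 1))) := by
        gcongr; exact succ_le_two_pow i
    _ = _ := by rw [mul_pow]; ring

/-- Differential operators preserve Gevrey series of order `s`. -/
theorem IsGevrey.apply {s : ℝ≥0∞} (hs : 1 ≤ s) {T : Module.End ℂ FormalSeries}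
    (hT : T ∈ diffOpAlgebra) : ∀ f, IsGevrey s f → IsGevrey s (T f) := by
  have hs' : s ≠ ⊤ → 1 ≤ s.toReal := fun h => by
    simpa using ENNReal.toReal_mono h hs
  induction hT using Algebra.adjoin_induction with
  | mem T hT =>
    rintro f ⟨hf, hf'⟩
    rcases hT with (rfl | rfl) | ⟨g, hg, rfl⟩
    · exact ⟨hf.d1, fun h => rhoConv_d1 (hf' h)⟩
    · exact ⟨hf.d2, fun h => rhoConv_d2 (hs' h) (hf' h)⟩
    · exact ⟨((isGevrey_one_iff g).2 hg).1.mul hf, fun h => rhoConv_mul (hs' h) hg (hf' h)⟩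
  | algebraMap c => exact fun f hf => ⟨hf.1.smul c, fun h => rhoConv_smul c (hf.2 h)⟩
  | add S T _ _ hS hT =>
    exact fun f hf => ⟨(hS f hf).1.add (hT f hf).1,
      fun h => rhoConv_add ((hS f hf).2 h) ((hT f hf).2 h)⟩
  | mul S T _ _ hS hT => exact fun f hf => hS _ (hT f hf)

theorem IsGevrey.zero (s : ℝ≥0∞) : IsGevrey s 0 :=
  ⟨IsFormalGerm.zero, fun _ => (isConvergent_rho_iff _ _).2
    ⟨0, 1, le_rfl, one_pos, fun i j => by simp [cf_zero]⟩⟩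

end Stability

/-! ### The `𝒟_{X,p}`-modules `𝒪_{X|Y}^(s)_p`, `𝒪_{X|Y,p}` and `𝒬_Y(s)_p` -/

/-- Germs at `p` of Gevrey series of order `s` along `Y`, `1 ≤ s ≤ ∞`. -/
def Gevrey (s : ℝ≥0∞) (hs : 1 ≤ s) : Submodule DiffOp FormalSeries where
  carrier := {f | IsGevrey s f}
  add_mem' hf hg := ⟨hf.1.add hg.1, fun h => rhoConv_add (hf.2 h) (hg.2 h)⟩
  zero_mem' := IsGevrey.zero s
  smul_mem' T f hf := IsGevrey.apply hs T.2 f hf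

/-- Germs at `p` of holomorphic functions, that is, convergent power series. -/
def Holo : Submodule DiffOp FormalSeries where
  carrier := {f | IsConvergent f}
  add_mem' {f g} hf hg := by
    simp only [Set.mem_ofPred_eq, ← isGevrey_one_iff] at *
    exact (Gevrey 1 le_rfl).add_mem hf hg
  zero_mem' := (isGevrey_one_iff 0).1 (IsGevrey.zero 1)
  smul_mem' T f hf := by
    simp only [Set.mem_ofPred_eq, ← isGevrey_one_iff] at *
    exact IsGevrey.apply le_rfl T.2 f hf

/-- `𝒬_Y(s)_p`, the Gevrey series of order `s` modulo the convergent ones. -/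
abbrev QY (s : ℝ≥0∞) (hs : 1 ≤ s) : Type :=
  Gevrey s hs ⧸ Holo.submoduleOf (Gevrey s hs)

/-! ### The hypergeometric module -/

/-- `∂₁` as an element of `𝒟_{X,p}`. -/
def D1 : DiffOp := ⟨d1, Algebra.subset_adjoin (by simp)⟩

/-- `∂₂` as an element of `𝒟_{X,p}`. -/
def D2 : DiffOp := ⟨d2, Algebra.subset_adjoin (by simp)⟩

/-- The coordinate function `x₁ = ε + t₁` at `p = (ε, 0)`. -/
def x1 (ε : ℂ) : FormalSeries :=
  FormalSeries.mk fun i => if i = 0 then PowerSeries.C ε + PowerSeries.X else 0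

/-- The coordinate function `x₂`. -/
def x2 : FormalSeries := FormalSeries.mk fun i => if i = 1 then 1 else 0

theorem isConvergent_x1 (ε : ℂ) : IsConvergent (x1 ε) := by
  refine (isConvergent_iff _).2 ⟨‖ε‖ + 1, 1, by positivity, one_pos, fun i j => ?_⟩
  simp only [x1, cf_mk, one_pow, mul_one]
  split_ifs with hi
  · simp only [map_add, PowerSeries.coeff_C, PowerSeries.coeff_X]
    refine (norm_add_le _ _).trans (add_le_add ?_ ?_) <;> split_ifs <;> simp
  · simp only [map_zero, norm_zero]; positivity

theorem isConvergent_x2 : IsConvergent x2 := by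
  refine (isConvergent_iff _).2 ⟨1, 1, by positivity, one_pos, fun i j => ?_⟩
  simp only [x2, cf_mk, one_pow, mul_one]
  split_ifs with hi
  · simp only [PowerSeries.coeff_one]; split_ifs <;> simp
  · simp

/-- Multiplication by `x₁`, in `𝒟_{X,p}`. -/
def X1 (ε : ℂ) : DiffOp :=
  ⟨LinearMap.mulLeft ℂ (x1 ε), Algebra.subset_adjoin (Or.inr ⟨_, isConvergent_x1 ε, rfl⟩)⟩

/-- Multiplication by `x₂`, in `𝒟_{X,p}`. -/
def X2 : DiffOp :=
  ⟨LinearMap.mulLeft ℂ x2, Algebra.subset_adjoin (Or.inr ⟨_, isConvergent_x2, rfl⟩)⟩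

/-- `P = ∂₁ ^ b - ∂₂ ^ a`. -/
def P (a b : ℕ) : DiffOp := D1 ^ b - D2 ^ a

/-- `E_A(β) = a x₁ ∂₁ + b x₂ ∂₂ - β`, at `p = (ε, 0)`. -/
def E (a b : ℕ) (β ε : ℂ) : DiffOp :=
  (a : ℂ) • (X1 ε * D1) + (b : ℂ) • (X2 * D2) - algebraMap ℂ DiffOp β

/-- The stalk at `p = (ε, 0)` of `ℳ_A(β)`: the quotient of `𝒟_{X,p}` by the left ideal generated by
`P` and `E_A(β)`. -/
abbrev M (a b : ℕ) (β ε : ℂ) : Type :=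
  DiffOp ⧸ Submodule.span DiffOp {P a b, E a b β ε}

/-- The stalk at `p = (ε, 0)` of `ℰxt⁰(ℳ_A(β), 𝒬_Y(s))`, i.e. of
`ℋom_𝒟(ℳ_A(β), 𝒬_Y(s))`: the `𝒟_{X,p}`-linear maps from `ℳ_A(β)_p` to `𝒬_Y(s)_p`. -/
abbrev Ext0 (a b : ℕ) (β ε : ℂ) (s : ℝ≥0∞) (hs : 1 ≤ s) : Type :=
  M a b β ε →ₗ[DiffOp] QY s hs

/-- `u` is the element of `ℰxt⁰` given by the class modulo `𝒪_{X|Y,p}` of the Gevrey series `f`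
(that is, `u` maps the generator `1` of `ℳ_A(β)_p` to this class). -/
def IsClassOf {a b : ℕ} {β ε : ℂ} {s : ℝ≥0∞} {hs : 1 ≤ s} (u : Ext0 a b β ε s hs)
    (f : FormalSeries) : Prop :=
  ∃ h : f ∈ Gevrey s hs,
    u (Submodule.Quotient.mk (1 : DiffOp)) = Submodule.Quotient.mk (⟨f, h⟩ : Gevrey s hs)

/-! ### `Γ`-series -/

/-- `(z)_n = z (z - 1) ⋯ (z - n + 1)`. -/
def poch (z : ℂ) (n : ℕ) : ℂ := ∏ j ∈ Finset.range n, (z - j)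

/-- `(z)_α` for `z ∈ ℂ²` and `α ∈ ℕ²`. -/
def poch2 (z : ℂ × ℂ) (α : ℕ × ℕ) : ℂ := poch z.1 α.1 * poch z.2 α.2

open Classical in
/-- `Γ[v; u] = (v)_{u₋} / (v + u)_{u₊}` if the denominator is nonzero, and `0` otherwise. -/
def Gam (v : ℂ × ℂ) (u : ℤ × ℤ) : ℂ :=
  if poch2 (v.1 + u.1, v.2 + u.2) (u.1.toNat, u.2.toNat) ≠ 0 then
    poch2 v ((-u.1).toNat, (-u.2).toNat) / poch2 (v.1 + u.1, v.2 + u.2) (u.1.toNat, u.2.toNat)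
  else 0

/-- Taylor series in `t₁` of the branch `exp (γ (l + log (1 + t₁ / ε)))` of `(t₁ + ε) ^ γ`
determined by a logarithm `l` of `ε`: the `j`-th coefficient is
`exp (γ l) (γ)_j / (j! ε ^ j)`. -/
def powSeries (ε l γ : ℂ) : PowerSeries ℂ :=
  PowerSeries.mk fun j => Complex.exp (γ * l) * poch γ j / ((j ! : ℂ) * ε ^ j)

/-- `x₁ ^ γ x₂ ^ n ∑ Γ[(γ, n); (-b m, a m)] x₁ ^ (-b m) x₂ ^ (a m)`, the sum being over all `m ∈ ℕ`
with `b m ≥ c`, as a series at `p = (ε, 0)`; powers of `x₁` are taken with the branch given by the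
logarithm `l` of `ε`. The coefficient of `x₂ ^ i` involves the `m` with `n + a m = i`. -/
def gammaSeries (a b : ℕ) (ε l γ : ℂ) (n c : ℕ) : FormalSeries :=
  FormalSeries.mk fun i => ∑ m ∈ (Finset.range (i + 1)).filter (fun m => n + a * m = i ∧ c ≤ b * m),
    Gam (γ, n) (-(b * m : ℤ), (a * m : ℤ)) • powSeries ε l (γ - b * m)

/-- The germ at `p` of the `Γ`-series of `v^k = ((β - k b) / a, k)`. -/
def phi (a b : ℕ) (β ε l : ℂ) (k : ℕ) : FormalSeries :=
  gammaSeries a b ε l ((β - k * b) / a) k 0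

/-- The smallest `m'` with `b m' ≥ m₀ + 1`. -/
def mPrime (b m₀ : ℕ) : ℕ := sInf {m : ℕ | m₀ + 1 ≤ b * m}

/-- For `β = q b + a m₀`, the germ at `p` of the modified series
`x ^ w ∑ Γ[w; u(m)] x₁ ^ (-b m) x₂ ^ (a m)`, sum over `m ∈ ℕ` with `b m ≥ m₀ + 1`, where
`w = (m₀ - b m', q + a m')` and `m'` is the smallest integer with `b m' ≥ m₀ + 1`. -/
def phiTilde (a b : ℕ) (ε l : ℂ) (q m₀ : ℕ) : FormalSeries :=
  gammaSeries a b ε l ((m₀ : ℂ) - b * mPrime b m₀) (q + a * mPrime b m₀) (m₀ + 1)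

end

end GKZ

namespace GKZ

/-! ### Coefficients of `E • f` and `P • f` -/

/-! A homomorphism out of the cyclic module is the class of a Gevrey series `f` with `E • f` and `P
• f` convergent (`exists_series`, `exists_isClassOf`), and it vanishes exactly when `f` converges.

Since `ε ≠ 0`, `E` is a nonsingular first-order operator in `t₁` that does not mix the powers of
`x₂`. Hence, when `E • f` is convergent, the convergence or Gevrey order of `f` can be read off from
its restriction `cᵢ = cf f i 0` to `t₁ = 0` (`norm_cf_le`, `isConvergent_rho_of_E`). Modulo
convergent series one may then assume `E • f = 0`. As `E` commutes with `P` up to a shift of `β`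
(`E_smul_P_smul`), convergence of `P • f` says that `cᵢ * indicial i - c_{i+a} * (i+a)!/i!` is
geometrically bounded: one approximate two-term recurrence for each residue class modulo `a`.

Because `indicial i` has the size of `((i+a)!/i!) ^ (b/a)`, nonzero solutions of the exact
recurrence grow like `(i!) ^ (b/a - 1)`, up to geometric factors. Dividing an approximate solution
by an exact one gives a convergent sequence; its limit `A` is the only invariant, the remainder
being geometrically bounded (`exists_norm_sub_mul_le`). So a class amounts to `a` constants, one per
residue. The growth rate gives Gevrey order `s` for `s ≥ b/a` and forces all constants to vanish for
`s < b/a` (`eq_zero_of_gevrey_bound`).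

It remains to exhibit one nonterminating solution per residue. The `Γ`-series do this; when `β ∈ aℕ
+ bℕ` the one for the residue `q` terminates, and the modified series, started after the
termination, replaces it: it solves the recurrence from some point on, which is enough. -/

theorem cf_neg (f : FormalSeries) (i j : ℕ) : cf (-f) i j = -cf f i j := by
  rw [← neg_one_smul ℂ f, cf_smul, neg_one_mul]

theorem cf_sub (f g : FormalSeries) (i j : ℕ) : cf (f - g) i j = cf f i j - cf g i j := by
  rw [sub_eq_add_neg, cf_add, cf_neg, sub_eq_add_neg]

theorem cf_sum {ι : Type*} (t : Finset ι) (f : ι → FormalSeries) (i j : ℕ) :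
    cf (∑ k ∈ t, f k) i j = ∑ k ∈ t, cf (f k) i j := by
  classical
  induction t using Finset.induction_on with
  | empty => simp [cf_zero]
  | insert k t hk ih => rw [Finset.sum_insert hk, Finset.sum_insert hk, cf_add, ih]

theorem D1_smul (f : FormalSeries) : D1 • f = d1 f := rfl

theorem D2_smul (f : FormalSeries) : D2 • f = d2 f := rfl

theorem X1_smul (ε : ℂ) (f : FormalSeries) : X1 ε • f = x1 ε * f := rfl

theorem X2_smul (f : FormalSeries) : X2 • f = x2 * f := rfl

theorem FormalSeries.coeff_mk (F : ℕ → PowerSeries ℂ) (i : ℕ) : (FormalSeries.mk F).coeff i = F i :=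
  PowerSeries.coeff_mk (R := PowerSeries ℂ) i F

theorem coeff_x1_mul (ε : ℂ) (f : FormalSeries) (i : ℕ) :
    (x1 ε * f).coeff i = (PowerSeries.C ε + PowerSeries.X) * f.coeff i := by
  have h : x1 ε = (PowerSeries.C (R := PowerSeries ℂ) (PowerSeries.C ε + PowerSeries.X)) := by
    refine PowerSeries.ext (R := PowerSeries ℂ) fun n => ?_
    rw [PowerSeries.coeff_C]
    exact FormalSeries.coeff_mk _ n
  rw [h]
  exact PowerSeries.coeff_C_mul (R := PowerSeries ℂ) i f _

theorem coeff_x2_mul (f : FormalSeries) (i : ℕ) :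
    (x2 * f).coeff i = if i = 0 then 0 else f.coeff (i - 1) := by
  have h : x2 = (PowerSeries.X : PowerSeries (PowerSeries ℂ)) := by
    refine PowerSeries.ext (R := PowerSeries ℂ) fun n => ?_
    rw [PowerSeries.coeff_X]
    exact FormalSeries.coeff_mk _ n
  rw [h]
  cases i with
  | zero => exact PowerSeries.coeff_zero_X_mul (R := PowerSeries ℂ) f
  | succ i => exact PowerSeries.coeff_succ_X_mul (R := PowerSeries ℂ) i f

theorem cf_x1_mul_d1 (ε : ℂ) (f : FormalSeries) (i j : ℕ) :
    cf (x1 ε * d1 f) i j = ε * (j + 1) * cf f i (j + 1) + j * cf f i j := by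
  rw [cf, coeff_x1_mul, add_mul, map_add, PowerSeries.coeff_C_mul, ← cf.eq_1, cf_d1]
  cases j with
  | zero => rw [PowerSeries.coeff_zero_X_mul]; push_cast; ring
  | succ j => rw [PowerSeries.coeff_succ_X_mul, ← cf.eq_1, cf_d1]; push_cast; ring

theorem cf_x2_mul_d2 (f : FormalSeries) (i j : ℕ) : cf (x2 * d2 f) i j = i * cf f i j := by
  rw [cf, coeff_x2_mul]
  cases i with
  | zero => simp
  | succ i =>
    simp only [Nat.succ_ne_zero, if_false, Nat.add_sub_cancel]
    rw [← cf.eq_1, cf_d2]; push_cast; ring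

/-- For fixed `i` this is a recurrence in `j` alone. Its leading coefficient `a ε (j + 1)` is
nonzero when `a` and `ε` are, so `E • f` and the value at `t₁ = 0` determine each `fᵢ`. -/
theorem cf_E (a b : ℕ) (β ε : ℂ) (f : FormalSeries) (i j : ℕ) :
    cf (E a b β ε • f) i j =
      a * ε * (j + 1) * cf f i (j + 1) + (a * j + b * i - β) * cf f i j := by
  have h : E a b β ε • f = (a : ℂ) • (x1 ε * d1 f) + (b : ℂ) • (x2 * d2 f) - β • f := by
    rw [E, sub_smul, add_smul, smul_assoc, smul_assoc, mul_smul, mul_smul, D1_smul, D2_smul,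
      X1_smul, X2_smul, algebraMap_smul]
  rw [h, cf_sub, cf_add, cf_smul, cf_smul, cf_smul, cf_x1_mul_d1, cf_x2_mul_d2]
  ring

theorem cf_D1_pow (n : ℕ) (f : FormalSeries) (i j : ℕ) :
    cf (D1 ^ n • f) i j = cf f i (j + n) * ((j + n)! / j !) := by
  induction n generalizing j with
  | zero => simp [Nat.factorial_ne_zero]
  | succ n ih =>
    have hj : ((j ! : ℕ) : ℂ) ≠ 0 := by exact_mod_cast Nat.factorial_ne_zero j
    have hj' : ((j : ℂ) + 1) ≠ 0 := by exact_mod_cast Nat.succ_ne_zero j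
    rw [pow_succ', mul_smul, D1_smul, cf_d1, ih, Nat.factorial_succ j,
      show j + 1 + n = j + (n + 1) by ring]
    push_cast
    field_simp

theorem cf_D2_pow (n : ℕ) (f : FormalSeries) (i j : ℕ) :
    cf (D2 ^ n • f) i j = cf f (i + n) j * ((i + n)! / i !) := by
  induction n generalizing i with
  | zero => simp [Nat.factorial_ne_zero]
  | succ n ih =>
    have hj : ((i ! : ℕ) : ℂ) ≠ 0 := by exact_mod_cast Nat.factorial_ne_zero i
    have hj' : ((i : ℂ) + 1) ≠ 0 := by exact_mod_cast Nat.succ_ne_zero i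
    rw [pow_succ', mul_smul, D2_smul, cf_d2, ih, Nat.factorial_succ i,
      show i + 1 + n = i + (n + 1) by ring]
    push_cast
    field_simp

theorem cf_P (a b : ℕ) (f : FormalSeries) (i j : ℕ) :
    cf (P a b • f) i j =
      cf f i (j + b) * ((j + b)! / j !) - cf f (i + a) j * ((i + a)! / i !) := by
  rw [P, sub_smul, cf_sub, cf_D1_pow, cf_D2_pow]

/-- Both `∂₁ ^ b` and `∂₂ ^ a` lower by `a b` the weight measured by `a x₁ ∂₁ + b x₂ ∂₂`.
Consequently `P` maps solutions of `E` to solutions of a shifted `E`, and these are again controlled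
by their restriction to `t₁ = 0`. -/
theorem E_smul_P_smul (a b : ℕ) (β ε : ℂ) (f : FormalSeries) :
    E a b (β - a * b) ε • P a b • f = P a b • E a b β ε • f := by
  ext i j
  have hj : ((j ! : ℕ) : ℂ) ≠ 0 := by exact_mod_cast Nat.factorial_ne_zero j
  have hi : ((i ! : ℕ) : ℂ) ≠ 0 := by exact_mod_cast Nat.factorial_ne_zero i
  have hj' : ((j : ℂ) + 1) ≠ 0 := by exact_mod_cast Nat.succ_ne_zero j
  rw [cf_E, cf_P, cf_P, cf_P, cf_E, cf_E, Nat.factorial_succ j,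
    show j + 1 + b = (j + b) + 1 by ring, Nat.factorial_succ (j + b)]
  push_cast
  field_simp
  ring

/-! ### Bounds for series with `E • f` convergent -/

/-- The recurrence in `j` multiplies by at most a constant times `(N + j + 1) / (j + 1)`, where `N =
b i + ⌈‖β‖⌉`, and these quotients multiply up to a binomial coefficient. That coefficient is at most
`2 ^ (N + j)`, so the loss is only exponential in `i`. -/
theorem norm_cf_le {a b : ℕ} (ha : 0 < a) {β ε : ℂ} (hε : ε ≠ 0) {f : FormalSeries} {i : ℕ}
    {G R : ℝ} (hR : 0 ≤ R) (h0 : ‖cf f i 0‖ ≤ G)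
    (hE : ∀ j, ‖cf (E a b β ε • f) i j‖ ≤ G * R ^ j) (j : ℕ) :
    ‖cf f i j‖ ≤ G * (max R (2 / ‖ε‖)) ^ j * ((b * i + ⌈‖β‖⌉₊ + j).choose j : ℕ) := by
  have hG : 0 ≤ G := (norm_nonneg _).trans h0
  have hε' : 0 < ‖ε‖ := norm_pos_iff.2 hε
  have ha' : (1 : ℝ) ≤ a := by exact_mod_cast ha
  set K := max R (2 / ‖ε‖)
  set N := b * i + ⌈‖β‖⌉₊ with hN
  have hK0 : 0 ≤ K := hR.trans (le_max_left _ _)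
  have hKε : 2 ≤ ‖ε‖ * K := by
    have := (div_le_iff₀ hε').1 (le_max_right R (2 / ‖ε‖))
    linarith
  induction j with
  | zero => simpa using h0
  | succ j ih =>
    have hch : (((N + (j + 1)).choose (j + 1) : ℕ) : ℝ) * (j + 1) =
        ((N + j).choose j : ℕ) * (N + j + 1) := by
      have := Nat.add_one_mul_choose_eq (N + j) j
      have h2 : (((N + j + 1) * (N + j).choose j : ℕ) : ℝ) =
        (((N + j + 1).choose (j + 1) * (j + 1) : ℕ) : ℝ) := by rw [this]
      push_cast at h2
      rw [← add_assoc, ← h2]; ring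
    have hone : (1 : ℝ) ≤ ((N + j).choose j : ℕ) := by
      exact_mod_cast Nat.choose_pos (Nat.le_add_left j N)
    have hrec : (a * ε * (j + 1)) * cf f i (j + 1) =
        cf (E a b β ε • f) i j - (a * j + b * i - β) * cf f i j := by rw [cf_E]; ring
    have hn : ‖(a : ℂ) * ε * (j + 1)‖ = a * ‖ε‖ * (j + 1) := by
      rw [norm_mul, norm_mul, Complex.norm_natCast, ← Nat.cast_succ, Complex.norm_natCast,
        Nat.cast_succ]
    have hn2 : ‖(a : ℂ) * j + b * i - β‖ ≤ a * j + N := by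
      have h1 : ‖(a : ℂ) * j + b * i‖ = a * j + b * i := by
        rw [show (a : ℂ) * j + b * i = ((a * j + b * i : ℕ) : ℂ) by push_cast; ring,
          Complex.norm_natCast]; push_cast; ring
      have h2 := Nat.le_ceil ‖β‖
      refine (norm_sub_le _ _).trans ?_
      rw [h1, hN]; push_cast; linarith
    set F := G * K ^ j * ((N + j).choose j : ℕ) with hF
    have hF0 : 0 ≤ F := by positivity
    have hgF : G * R ^ j ≤ F := by
      calc G * R ^ j ≤ G * K ^ j * 1 := by rw [mul_one]; gcongr; exact le_max_left _ _
        _ ≤ F := by rw [hF]; gcongr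
    have hpos : 0 < a * ‖ε‖ * ((j : ℝ) + 1) := by positivity
    refine le_of_mul_le_mul_left ?_ hpos
    calc a * ‖ε‖ * ((j : ℝ) + 1) * ‖cf f i (j + 1)‖
        = ‖cf (E a b β ε • f) i j - (a * j + b * i - β) * cf f i j‖ := by
          rw [← hn, ← norm_mul, hrec]
      _ ≤ ‖cf (E a b β ε • f) i j‖ + ‖(a : ℂ) * j + b * i - β‖ * ‖cf f i j‖ := by
          rw [← norm_mul]; exact norm_sub_le _ _
      _ ≤ F + (a * j + N) * F :=
          add_le_add ((hE j).trans hgF) (mul_le_mul hn2 ih (norm_nonneg _) (by positivity))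
      -- The factor 2 absorbs the inhomogeneous term and is paid for by `2 ≤ ‖ε‖ * K`.
      _ ≤ (a * 2) * (N + j + 1) * F := by
          have hj0 : (0 : ℝ) ≤ j := by positivity
          have hN0 : (0 : ℝ) ≤ N := by positivity
          have : 1 + (a * j + N) ≤ (a * 2) * ((N : ℝ) + j + 1) := by nlinarith [mul_nonneg hj0 (by positivity : (0 : ℝ) ≤ a)]
          nlinarith
      _ ≤ (a * (‖ε‖ * K)) * (N + j + 1) * F := by gcongr
      _ = a * ‖ε‖ * (G * K ^ (j + 1)) * (((N + j).choose j : ℕ) * (N + j + 1)) := by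
          rw [hF]; ring
      _ = _ := by rw [← hch]; ring

theorem choose_le_two_pow_real (N j : ℕ) : ((N + j).choose j : ℝ) ≤ 2 ^ N * 2 ^ j := by
  rw [← pow_add]; exact_mod_cast Nat.choose_le_two_pow (N + j) j

theorem isConvergent_rho_of_E {a b : ℕ} (ha : 0 < a) {β ε : ℂ} (hε : ε ≠ 0) {f : FormalSeries}
    {s : ℝ} (hs : 1 ≤ s) (hE : IsConvergent (E a b β ε • f)) {C R : ℝ} (hC : 0 ≤ C) (hR : 0 < R)
    (h0 : ∀ i, ‖cf f i 0‖ ≤ C * R ^ i * (i ! : ℝ) ^ (s - 1)) : IsConvergent (rho s f) := by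
  obtain ⟨D, S, hD, hS, hE⟩ := (isConvergent_iff _).1 hE
  set T := max R S
  have hT : 0 < T := lt_max_of_lt_left hR
  have hw : ∀ i : ℕ, (1 : ℝ) ≤ (i ! : ℝ) ^ (s - 1) := fun i =>
    Real.one_le_rpow (by exact_mod_cast Nat.factorial_pos i) (by linarith)
  -- One `G` dominates both the initial value and the inhomogeneous term; the latter carries no
  -- factorial weight, but the weight is at least 1 because `s ≥ 1`.
  have key := fun i => norm_cf_le (i := i) (G := (C + D) * T ^ i * (i ! : ℝ) ^ (s - 1)) ha hε hS.le
    ((h0 i).trans (by gcongr; · linarith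
                      · exact le_max_left _ _))
    (fun j => (hE i j).trans (by
      rw [pow_add]
      calc D * (S ^ i * S ^ j) = D * S ^ i * 1 * S ^ j := by ring
        _ ≤ _ := by
          gcongr
          · linarith
          · exact le_max_right _ _
          · exact hw i))
  set K := max S (2 / ‖ε‖)
  have hK : 0 < K := lt_max_of_lt_left hS
  set B := ⌈‖β‖⌉₊
  refine (isConvergent_rho_iff _ _).2
    ⟨(C + D) * 2 ^ B, max (T * 2 ^ b) (K * 2), by positivity, lt_max_of_lt_left (by positivity),
      fun i j => (key i j).trans ?_⟩
  calc (C + D) * T ^ i * (i ! : ℝ) ^ (s - 1) * K ^ j * ((b * i + B + j).choose j : ℕ)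
      ≤ (C + D) * T ^ i * (i ! : ℝ) ^ (s - 1) * K ^ j * (2 ^ (b * i + B) * 2 ^ j) := by
        gcongr; exact choose_le_two_pow_real _ _
    _ = (C + D) * 2 ^ B * ((T * 2 ^ b) ^ i * (K * 2) ^ j) * (i ! : ℝ) ^ (s - 1) := by
        rw [mul_pow, mul_pow, ← pow_mul, pow_add]; ring
    _ ≤ _ := by
        rw [pow_add]; gcongr
        · exact le_max_left _ _
        · exact le_max_right _ _

theorem isConvergent_of_E {a b : ℕ} (ha : 0 < a) {β ε : ℂ} (hε : ε ≠ 0) {f : FormalSeries}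
    (hE : IsConvergent (E a b β ε • f)) {C R : ℝ} (hC : 0 ≤ C) (hR : 0 < R)
    (h0 : ∀ i, ‖cf f i 0‖ ≤ C * R ^ i) : IsConvergent f := by
  rw [← rho_one f]
  exact isConvergent_rho_of_E ha hε le_rfl hE hC hR (by simpa using h0)

/-- The rate `K` in `norm_cf_le` does not depend on `i`, so all `fᵢ` share a disc whatever the size
of their initial values. -/
theorem isFormalGerm_of_E {a b : ℕ} (ha : 0 < a) {β ε : ℂ} (hε : ε ≠ 0) {f : FormalSeries}
    (hE : IsConvergent (E a b β ε • f)) : IsFormalGerm f := by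
  obtain ⟨D, S, hD, hS, hE⟩ := (isConvergent_iff _).1 hE
  have key := fun i => norm_cf_le (i := i) (G := ‖cf f i 0‖ + D * S ^ i) ha hε hS.le
    (le_add_of_nonneg_right (by positivity))
    (fun j => (hE i j).trans (by
      rw [pow_add, ← mul_assoc]; gcongr; exact le_add_of_nonneg_left (by positivity)))
  set K := max S (2 / ‖ε‖)
  have hK : 0 < K := lt_max_of_lt_left hS
  refine (isFormalGerm_iff _).2 ⟨K * 2, by positivity, fun i =>
    ⟨(‖cf f i 0‖ + D * S ^ i) * 2 ^ (b * i + ⌈‖β‖⌉₊), by positivity, fun j => (key i j).trans ?_⟩⟩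
  calc (‖cf f i 0‖ + D * S ^ i) * K ^ j * ((b * i + ⌈‖β‖⌉₊ + j).choose j : ℕ)
      ≤ (‖cf f i 0‖ + D * S ^ i) * K ^ j * (2 ^ (b * i + ⌈‖β‖⌉₊) * 2 ^ j) := by
        gcongr; exact choose_le_two_pow_real _ _
    _ = _ := by rw [mul_pow]; ring

/-- Two series with `E • f` and `E • g` convergent are congruent modulo convergent series as soon as
their restrictions to `t₁ = 0` are. -/
theorem isConvergent_sub {a b : ℕ} (ha : 0 < a) {β ε : ℂ} (hε : ε ≠ 0) {f g : FormalSeries}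
    (hf : IsConvergent (E a b β ε • f)) (hg : IsConvergent (E a b β ε • g)) {C R : ℝ} (hC : 0 ≤ C)
    (hR : 0 < R) (h0 : ∀ i, ‖cf f i 0 - cf g i 0‖ ≤ C * R ^ i) : IsConvergent (f - g) := by
  refine isConvergent_of_E (a := a) (b := b) (β := β) ha hε ?_ hC hR (fun i => ?_)
  · rw [smul_sub]; exact Holo.sub_mem hf hg
  · rw [cf_sub]; exact h0 i

/-! ### Growth of sequences -/

/-- Glues eventual bounds along the residue classes modulo `a`; the finitely many exceptional
indices go into the constant. -/
theorem exists_geometric_bound {a : ℕ} (ha : 0 < a) {x : ℕ → ℝ}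
    (h : ∀ k : Fin a, ∃ C R : ℝ, ∃ N : ℕ, 0 ≤ C ∧ 1 ≤ R ∧ ∀ m ≥ N, x (k + a * m) ≤ C * R ^ m) :
    ∃ C R : ℝ, 0 ≤ C ∧ 0 < R ∧ ∀ i, x i ≤ C * R ^ i := by
  choose C R N hC hR hx using h
  set M := ∑ k, a * (N k + 1) with hM
  set S := 1 + ∑ k, R k with hS
  set D := ∑ k, C k + ∑ j ∈ Finset.range M, |x j| with hD
  have hR0 : ∀ k, 0 ≤ R k := fun k => zero_le_one.trans (hR k)
  have hCs : 0 ≤ ∑ k, C k := Finset.sum_nonneg fun k _ => hC k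
  have hxs : 0 ≤ ∑ j ∈ Finset.range M, |x j| := Finset.sum_nonneg fun k _ => abs_nonneg _
  have hS1 : 1 ≤ S := le_add_of_nonneg_right (Finset.sum_nonneg fun k _ => hR0 k)
  refine ⟨D, S, by positivity, by linarith, fun i => ?_⟩
  by_cases hi : i < M
  · calc x i ≤ |x i| := le_abs_self _
      _ ≤ ∑ j ∈ Finset.range M, |x j| :=
        Finset.single_le_sum (f := fun j => |x j|) (fun j _ => abs_nonneg _)
          (Finset.mem_range.2 hi)
      _ ≤ D * 1 := by linarith
      _ ≤ D * S ^ i := by gcongr; exact one_le_pow₀ hS1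
  · set k : Fin a := ⟨i % a, Nat.mod_lt i ha⟩ with hk
    have hik : (k : ℕ) + a * (i / a) = i := Nat.mod_add_div i a
    have hMk : a * (N k + 1) ≤ M :=
      Finset.single_le_sum (f := fun k => a * (N k + 1)) (fun _ _ => Nat.zero_le _)
        (Finset.mem_univ k)
    have hN : N k ≤ i / a := by
      rw [Nat.le_div_iff_mul_le ha]
      have : a * (N k + 1) = N k * a + a := by ring
      omega
    have hRS : R k ≤ S := by
      have := Finset.single_le_sum (f := R) (fun k _ => hR0 k) (Finset.mem_univ k)
      linarith
    have hCD : C k ≤ D := by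
      have := Finset.single_le_sum (f := C) (fun k _ => hC k) (Finset.mem_univ k)
      linarith
    have := hx k _ hN
    rw [hik] at this
    calc x i ≤ C k * R k ^ (i / a) := this
      _ ≤ D * S ^ (i / a) :=
        mul_le_mul hCD (pow_le_pow_left₀ (hR0 k) hRS _) (pow_nonneg (hR0 k) _)
          ((hC k).trans hCD)
      _ ≤ D * S ^ i :=
        mul_le_mul_of_nonneg_left (pow_le_pow_right₀ hS1 (Nat.div_le_self i a))
          ((hC k).trans hCD)

/-- Taking `1 / δ`-th powers reduces this to `x ^ m / m! → 0`. -/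
theorem exists_lt_factorial_rpow {δ : ℝ} (hδ : 0 < δ) {D T : ℝ} (hD : 0 < D) (hT : 0 < T)
    (M : ℕ) : ∃ m ≥ M, D * T ^ m < (m ! : ℝ) ^ δ := by
  have h := FloorSemiring.tendsto_pow_div_factorial_atTop (T ^ (1 / δ))
  have hpos : 0 < D ^ (-(1 / δ)) := Real.rpow_pos_of_pos hD _
  obtain ⟨m, hm, hmM⟩ := ((h.eventually (gt_mem_nhds hpos)).and
    (Filter.eventually_ge_atTop M)).exists
  refine ⟨m, hmM, ?_⟩
  have hf : (0 : ℝ) < m ! := by positivity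
  have h1 : D ^ (1 / δ) * (T ^ (1 / δ)) ^ m < m ! := by
    rw [div_lt_iff₀ hf, Real.rpow_neg hD.le, inv_mul_eq_div, lt_div_iff₀
      (Real.rpow_pos_of_pos hD _)] at hm
    linarith
  have h2 := Real.rpow_lt_rpow (by positivity) h1 hδ
  rwa [Real.mul_rpow (by positivity) (by positivity), ← Real.rpow_mul hD.le,
    ← Real.rpow_natCast, ← Real.rpow_mul hT.le, ← Real.rpow_mul hT.le,
    show 1 / δ * m * δ = m by field_simp, one_div_mul_cancel hδ.ne', Real.rpow_one,
    Real.rpow_natCast] at h2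

/-- A solution of an inhomogeneous first order recurrence with geometrically bounded right hand
side differs from a multiple of a rapidly growing homogeneous solution by a geometrically bounded
sequence. -/
theorem exists_norm_sub_mul_le {e h r d s : ℕ → ℂ} {N : ℕ} (hs : ∀ m, 1 ≤ ‖s m‖)
    (he : ∀ m, e m * r m = d m + e (m + 1) * s m)
    (hh : ∀ m ≥ N, h m * r m = h (m + 1) * s m) (hne : ∀ m ≥ N, h m ≠ 0)
    (hgrow : ∀ K : ℝ, ∃ N', ∀ m ≥ N', K * ‖h m‖ ≤ ‖h (m + 1)‖)
    {C R : ℝ} (hC : 0 ≤ C) (hR : 1 ≤ R) (hd : ∀ m, ‖d m‖ ≤ C * R ^ m) :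
    ∃ A : ℂ, ∃ N' : ℕ, ∀ m ≥ N', ‖e m - A * h m‖ ≤ C * R ^ m := by
  -- Growth of `h` by `2 * R` against `R ^ m` for `d` makes the increments of `e / h` decay like `2
  -- ^ (-j)`.
  obtain ⟨N₁, hN₁⟩ := hgrow (2 * R)
  set N' := max N N₁
  have hR0 : 0 < R := one_pos.trans_le hR
  have hpow : ∀ m ≥ N', ∀ j, (2 * R) ^ j * ‖h m‖ ≤ ‖h (m + j)‖ := fun m hm j => by
    induction j with
    | zero => simp
    | succ j ih =>
      calc (2 * R) ^ (j + 1) * ‖h m‖ = 2 * R * ((2 * R) ^ j * ‖h m‖) := by ring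
        _ ≤ 2 * R * ‖h (m + j)‖ := by gcongr
        _ ≤ _ := hN₁ _ ((le_max_right N N₁).trans (hm.le.trans (Nat.le_add_right m j)))
  have hstep : ∀ m ≥ N', ∀ j, dist (e (m + j) / h (m + j)) (e (m + (j + 1)) / h (m + (j + 1))) ≤
      C * R ^ m / ‖h m‖ / 2 / 2 ^ j := fun m hm j => by
    have hmj : N ≤ m + j := (le_max_left N N₁).trans (hm.le.trans (Nat.le_add_right m j))
    have h0 := hne m ((le_max_left N N₁).trans hm)
    have h1 := hne _ hmj
    have h2 := hne (m + j + 1) (by omega)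
    have hs0 : s (m + j) ≠ 0 := norm_pos_iff.1 (one_pos.trans_le (hs _))
    have key : e (m + j) / h (m + j) - e (m + j + 1) / h (m + j + 1) =
        d (m + j) / (s (m + j) * h (m + j + 1)) := by
      have h3 := he (m + j)
      have h4 := hh (m + j) hmj
      rw [div_sub_div _ _ h1 h2, div_eq_div_iff (mul_ne_zero h1 h2) (mul_ne_zero hs0 h2)]
      linear_combination h (m + j + 1) * h (m + j) * h3 - h (m + j + 1) * e (m + j) * h4
    have hb := hpow m hm (j + 1)
    have hm0 : 0 < ‖h m‖ := norm_pos_iff.2 h0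
    have h20 : 0 < ‖h (m + j + 1)‖ := norm_pos_iff.2 h2
    rw [← add_assoc] at hb
    rw [dist_eq_norm, ← add_assoc, key, norm_div, norm_mul]
    calc ‖d (m + j)‖ / (‖s (m + j)‖ * ‖h (m + j + 1)‖)
        ≤ (C * R ^ (m + j)) / (1 * ((2 * R) ^ (j + 1) * ‖h m‖)) := by
          gcongr
          · exact hd _
          · exact hs _
      _ = C * R ^ m / ‖h m‖ / 2 / 2 ^ j / R := by
          rw [mul_pow]; field_simp; ring
      _ ≤ _ := div_le_self (by positivity) hR
  obtain ⟨A, hA⟩ := cauchySeq_tendsto_of_complete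
    (cauchySeq_of_le_geometric_two (hstep N' le_rfl))
  have hA' : Filter.Tendsto (fun m => e m / h m) Filter.atTop (nhds A) := by
    rw [← Filter.tendsto_add_atTop_iff_nat N']
    simpa only [add_comm] using hA
  refine ⟨A, N', fun m hm => ?_⟩
  have hm0 := hne m ((le_max_left N N₁).trans hm)
  have hlim : Filter.Tendsto (fun j => e (m + j) / h (m + j)) Filter.atTop (nhds A) := by
    have := (Filter.tendsto_add_atTop_iff_nat m).2 hA'
    simpa only [add_comm] using this
  -- The tail of the series of increments from `m` on sums to at most `C * R ^ m / ‖h m‖`;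
  -- multiplying by `h m` gives the claim.
  have h1 := dist_le_of_le_geometric_two_of_tendsto₀ (hstep m hm) hlim
  rw [add_zero, dist_eq_norm, le_div_iff₀ (norm_pos_iff.2 hm0), ← norm_mul, sub_mul,
    div_mul_cancel₀ _ hm0] at h1
  exact h1

/-! ### The indicial coefficients -/

/-- The value at `t₁ = 0` of `∂₁ ^ b x₁ ^ γ / x₁ ^ γ` for `γ = (β - b i) / a`. -/
noncomputable def indicial (a b : ℕ) (β ε : ℂ) (i : ℕ) : ℂ :=
  poch ((β - b * i) / a) b / ε ^ b

theorem norm_poch_le {z : ℂ} {n : ℕ} {K : ℝ} (h : ∀ j < n, ‖z - j‖ ≤ K) : ‖poch z n‖ ≤ K ^ n := by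
  rw [poch, norm_prod]
  calc _ ≤ ∏ _j ∈ Finset.range n, K :=
        Finset.prod_le_prod (fun _ _ => norm_nonneg _) fun j hj => h j (Finset.mem_range.1 hj)
    _ = _ := by simp

theorem le_norm_poch {z : ℂ} {n : ℕ} {K : ℝ} (hK : 0 ≤ K) (h : ∀ j < n, K ≤ ‖z - j‖) :
    K ^ n ≤ ‖poch z n‖ := by
  rw [poch, norm_prod]
  calc _ = ∏ _j ∈ Finset.range n, K := by simp
    _ ≤ _ := Finset.prod_le_prod (fun _ _ => hK) fun j hj => h j (Finset.mem_range.1 hj)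

theorem factorial_ratio_bounds {a : ℕ} (ha : 0 < a) (i : ℕ) :
    ((i : ℝ) + 1) ^ a ≤ ((i + a)! : ℝ) / i ! ∧
      ((i + a)! : ℝ) / i ! ≤ (a * ((i : ℝ) + 1)) ^ a := by
  have hf : (0 : ℝ) < i ! := by positivity
  have h : ((i + a)! : ℝ) / i ! = ((i + 1).ascFactorial a : ℕ) := by
    rw [div_eq_iff hf.ne', mul_comm]; exact_mod_cast (Nat.factorial_mul_ascFactorial i a).symm
  rw [h]
  constructor
  · exact_mod_cast Nat.pow_succ_le_ascFactorial (i + 1) a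
  · have h1 := Nat.ascFactorial_le_pow_add i a
    have h2 : i + a ≤ a * (i + 1) := by nlinarith
    exact_mod_cast h1.trans (Nat.pow_le_pow_left h2 a)

/-- Each of the `b` factors of `poch` has size comparable to `i`, whereas `(i + a)! / i!` is
comparable to `i ^ a`; hence the exponent `b / a`. -/
theorem indicial_bounds {a b : ℕ} (ha : 0 < a) (hab : a < b) (β : ℂ) {ε : ℂ} (hε : ε ≠ 0) :
    ∃ k₁ k₂ : ℝ, ∃ N : ℕ, 0 < k₁ ∧ 0 < k₂ ∧ ∀ i ≥ N,
      k₁ * (((i + a)! : ℝ) / i !) ^ ((b : ℝ) / a) ≤ ‖indicial a b β ε i‖ ∧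
      ‖indicial a b β ε i‖ ≤ k₂ * (((i + a)! : ℝ) / i !) ^ ((b : ℝ) / a) := by
  have hε' : 0 < ‖ε‖ := norm_pos_iff.2 hε
  have ha' : (1 : ℝ) ≤ a := by exact_mod_cast ha
  have hb0 : 0 < b := ha.trans hab
  have hab' : (a : ℝ) ≤ b := by exact_mod_cast hab.le
  have hK : 0 < (b : ℝ) + ‖β‖ := by positivity
  refine ⟨((1 / (2 * a)) / ‖ε‖) ^ b, ((b + ‖β‖) / ‖ε‖) ^ b, ⌈1 + 2 * ‖β‖⌉₊, by positivity,
    by positivity, fun i hi => ?_⟩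
  -- This threshold is what makes `i - ‖β‖ ≥ (i + 1) / 2`.
  have hi' : 1 + 2 * ‖β‖ ≤ i := Nat.ceil_le.1 hi
  obtain ⟨h1, h2⟩ := factorial_ratio_bounds ha i
  have hp : ∀ x : ℝ, 0 ≤ x → (x ^ a) ^ ((b : ℝ) / a) = x ^ b := fun x hx => by
    rw [← Real.rpow_natCast, ← Real.rpow_mul hx, mul_div_cancel₀ _ (by positivity),
      Real.rpow_natCast]
  have h1' := Real.rpow_le_rpow (by positivity) h1 (by positivity : 0 ≤ (b : ℝ) / a)
  have h2' := Real.rpow_le_rpow (by positivity) h2 (by positivity : 0 ≤ (b : ℝ) / a)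
  rw [hp _ (by positivity)] at h1' h2'
  have hfac : ∀ j : ℕ, (β - b * i) / a - j = β / a - ((b / a * i + j : ℝ) : ℂ) := fun j => by
    push_cast; ring
  have hre : ∀ j : ℕ, ‖((b / a * i + j : ℝ) : ℂ)‖ = b / a * i + j := fun j => by
    rw [Complex.norm_real, Real.norm_of_nonneg (by positivity)]
  have hβa : ‖β / a‖ ≤ ‖β‖ := by
    rw [norm_div, Complex.norm_natCast]; exact div_le_self (norm_nonneg _) ha'
  have hi0 : (0 : ℝ) ≤ i := by positivity
  have hlow : (((i : ℝ) + 1) / 2) ^ b ≤ ‖poch ((β - b * i) / a) b‖ := by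
    refine le_norm_poch (by positivity) fun j _ => ?_
    have h3 : (i : ℝ) ≤ b / a * i := le_mul_of_one_le_left hi0 ((one_le_div (by linarith)).2 hab')
    have h4 := norm_sub_norm_le ((b / a * i + j : ℝ) : ℂ) (β / a)
    rw [norm_sub_rev, ← hfac, hre] at h4
    have : (0 : ℝ) ≤ j := by positivity
    linarith
  have hup : ‖poch ((β - b * i) / a) b‖ ≤ ((b + ‖β‖) * ((i : ℝ) + 1)) ^ b := by
    refine norm_poch_le fun j hj => ?_
    have h3 : b / a * (i : ℝ) ≤ b * i := by gcongr; exact div_le_self (by positivity) ha'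
    have h4 := norm_sub_le (β / a) ((b / a * i + j : ℝ) : ℂ)
    rw [← hfac, hre] at h4
    have h5 : (j : ℝ) ≤ b := by exact_mod_cast hj.le
    nlinarith [mul_nonneg (norm_nonneg β) hi0]
  rw [indicial, norm_div, norm_pow]
  constructor
  · calc _ ≤ ((1 / (2 * a)) / ‖ε‖) ^ b * (a * ((i : ℝ) + 1)) ^ b := by gcongr
      _ = (((i : ℝ) + 1) / 2) ^ b / ‖ε‖ ^ b := by
        rw [← mul_pow, ← div_pow]; congr 1; field_simp
      _ ≤ _ := by gcongr
  · calc _ ≤ ((b + ‖β‖) * ((i : ℝ) + 1)) ^ b / ‖ε‖ ^ b := by gcongr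
      _ = ((b + ‖β‖) / ‖ε‖) ^ b * ((i : ℝ) + 1) ^ b := by
        rw [← mul_pow, ← div_pow]; congr 1; field_simp
      _ ≤ _ := by gcongr

/-! ### Basic solutions -/

/-- `f` solves `E • f = 0`, is supported on the powers `x₂ ^ i` with `i ≡ k` modulo `a`, and its
restriction to `t₁ = 0` satisfies the recurrence expressing `P • f = 0` from some point on, without
terminating. -/
structure IsBasicSolution (a b : ℕ) (β ε : ℂ) (k : ℕ) (f : FormalSeries) : Prop where
  E_smul : E a b β ε • f = 0
  support : ∀ i, i % a ≠ k → cf f i 0 = 0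
  recurrence : ∃ N, ∀ i ≥ N,
    cf f i 0 * indicial a b β ε i = cf f (i + a) 0 * ((i + a)! / i ! : ℂ)
  ne_zero : ∃ N, ∀ m ≥ N, cf f (k + a * m) 0 ≠ 0

/-- Each `fᵢ` is the binomial series of a multiple of `(1 + t₁ / ε) ^ ((β - b i) / a)`. -/
theorem cf_of_E_smul_eq_zero {a b : ℕ} (ha : 0 < a) {β ε : ℂ} (hε : ε ≠ 0) {f : FormalSeries}
    (hf : E a b β ε • f = 0) (i j : ℕ) :
    cf f i j = cf f i 0 * (poch ((β - b * i) / a) j / (j ! * ε ^ j)) := by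
  have ha' : (a : ℂ) ≠ 0 := by exact_mod_cast ha.ne'
  induction j with
  | zero => simp [poch]
  | succ j ih =>
    have hj : ((j ! : ℕ) : ℂ) ≠ 0 := by exact_mod_cast Nat.factorial_ne_zero j
    have hj' : ((j : ℂ) + 1) ≠ 0 := by exact_mod_cast Nat.succ_ne_zero j
    have h := cf_E a b β ε f i j
    rw [hf, cf_zero, ih] at h
    rw [poch, Finset.prod_range_succ, ← poch.eq_1, Nat.factorial_succ]
    refine mul_left_cancel₀ (mul_ne_zero (mul_ne_zero ha' hε) hj') ?_
    rw [eq_comm, add_eq_zero_iff_eq_neg] at h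
    rw [h]
    push_cast
    field_simp
    ring

theorem exists_E_smul_eq_zero {a : ℕ} (ha : 0 < a) (b : ℕ) (β : ℂ) {ε : ℂ} (hε : ε ≠ 0)
    (c : ℕ → ℂ) : ∃ f, E a b β ε • f = 0 ∧ ∀ i, cf f i 0 = c i := by
  have ha' : (a : ℂ) ≠ 0 := by exact_mod_cast ha.ne'
  have hcf : ∀ i j, cf (FormalSeries.mk fun i => PowerSeries.mk fun j =>
      c i * (poch ((β - b * i) / a) j / (j ! * ε ^ j))) i j =
      c i * (poch ((β - b * i) / a) j / (j ! * ε ^ j)) := fun i j => by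
    rw [cf_mk, PowerSeries.coeff_mk]
  refine ⟨_, ?_, fun i => (hcf i 0).trans (by simp [poch])⟩
  ext i j
  have hj : ((j ! : ℕ) : ℂ) ≠ 0 := by exact_mod_cast Nat.factorial_ne_zero j
  have hj' : ((j : ℂ) + 1) ≠ 0 := by exact_mod_cast Nat.succ_ne_zero j
  rw [cf_E, hcf, hcf, cf_zero, poch, Finset.prod_range_succ, ← poch.eq_1, Nat.factorial_succ]
  push_cast
  field_simp
  ring

theorem cf_P_of_E_smul_eq_zero {a b : ℕ} (ha : 0 < a) {β ε : ℂ} (hε : ε ≠ 0) {f : FormalSeries}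
    (hf : E a b β ε • f = 0) (i : ℕ) :
    cf (P a b • f) i 0 =
      cf f i 0 * indicial a b β ε i - cf f (i + a) 0 * ((i + a)! / i ! : ℂ) := by
  have hb : ((b ! : ℕ) : ℂ) ≠ 0 := by exact_mod_cast Nat.factorial_ne_zero b
  rw [cf_P, cf_of_E_smul_eq_zero ha hε hf i (0 + b), indicial, zero_add, Nat.factorial_zero]
  push_cast
  field_simp

/-- If `E • f` and `P • f` are convergent, then the restriction of `f` to `t₁ = 0` satisfies the
recurrence of the basic solutions up to a geometrically bounded error. -/
theorem exists_recurrence_error_bound {a b : ℕ} (ha : 0 < a) {β ε : ℂ} (hε : ε ≠ 0)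
    {f : FormalSeries} (hE : IsConvergent (E a b β ε • f)) (hP : IsConvergent (P a b • f)) :
    ∃ C R : ℝ, 0 ≤ C ∧ 1 ≤ R ∧ ∀ i,
      ‖cf f i 0 * indicial a b β ε i - cf f (i + a) 0 * ((i + a)! / i ! : ℂ)‖ ≤ C * R ^ i := by
  -- Correct `f` by a convergent series to an exact solution `g` of `E` with the same restriction;
  -- then `P • g` is still convergent and its restriction is explicit.
  obtain ⟨g, hg, hgc⟩ := exists_E_smul_eq_zero ha b β hε fun i => cf f i 0
  have hfg : IsConvergent (f - g) :=
    isConvergent_sub ha hε hE (hg ▸ Holo.zero_mem) le_rfl one_pos (fun i => by simp [hgc])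
  have hPg : IsConvergent (P a b • g) := by
    have h : P a b • g = P a b • f - P a b • (f - g) := by rw [smul_sub, sub_sub_cancel]
    rw [h]
    exact Holo.sub_mem hP (Holo.smul_mem _ hfg)
  obtain ⟨C, R, hC, hR, h⟩ := (isConvergent_iff _).1 hPg
  refine ⟨C, max R 1, hC, le_max_right _ _, fun i => ?_⟩
  have := h i 0
  rw [cf_P_of_E_smul_eq_zero ha hε hg, hgc, hgc, add_zero] at this
  exact this.trans (by gcongr; exact le_max_left _ _)

namespace IsBasicSolution

variable {a b k : ℕ} {β ε : ℂ} {f : FormalSeries}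

theorem isConvergent_E (h : IsBasicSolution a b β ε k f) : IsConvergent (E a b β ε • f) :=
  h.E_smul ▸ Holo.zero_mem

/-- `P • f` need not vanish, since the recurrence may fail at finitely many indices. It is killed by
a shifted `E` and its restriction to `t₁ = 0` is eventually zero. -/
theorem isConvergent_P (ha : 0 < a) (hε : ε ≠ 0) (h : IsBasicSolution a b β ε k f) :
    IsConvergent (P a b • f) := by
  obtain ⟨N, hN⟩ := h.recurrence
  obtain ⟨C, R, hC, hR, hx⟩ := exists_geometric_bound one_pos
    (x := fun i => ‖cf (P a b • f) i 0‖) fun l => ⟨0, 1, N, le_rfl, le_rfl, fun m hm => by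
      rw [cf_P_of_E_smul_eq_zero ha hε h.E_smul, hN _ (by omega), sub_self]; simp⟩
  refine isConvergent_of_E (a := a) (b := b) (β := β - a * b) ha hε ?_ hC hR hx
  rw [E_smul_P_smul, h.E_smul, smul_zero]
  exact Holo.zero_mem

/-- Each step of the recurrence multiplies by `((i + a)! / i!) ^ (b / a - 1)`, up to constants. -/
theorem step_bounds (ha : 0 < a) (hab : a < b) (hε : ε ≠ 0) (h : IsBasicSolution a b β ε k f) :
    ∃ k₁ k₂ : ℝ, ∃ N : ℕ, 0 < k₁ ∧ 0 < k₂ ∧ ∀ i ≥ N,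
      k₁ * (((i + a)! : ℝ) / i !) ^ ((b : ℝ) / a - 1) * ‖cf f i 0‖ ≤ ‖cf f (i + a) 0‖ ∧
      ‖cf f (i + a) 0‖ ≤ k₂ * (((i + a)! : ℝ) / i !) ^ ((b : ℝ) / a - 1) * ‖cf f i 0‖ := by
  obtain ⟨k₁, k₂, N, hk₁, hk₂, hb⟩ := indicial_bounds ha hab β hε
  obtain ⟨N', hN'⟩ := h.recurrence
  refine ⟨k₁, k₂, max N N', hk₁, hk₂, fun i hi => ?_⟩
  obtain ⟨h1, h2⟩ := hb i ((le_max_left _ _).trans hi)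
  have h3 := congrArg norm (hN' i ((le_max_right _ _).trans hi))
  rw [norm_mul, norm_mul, norm_div, Complex.norm_natCast, Complex.norm_natCast] at h3
  have hq : 0 < ((i + a)! : ℝ) / i ! := by positivity
  rw [Real.rpow_sub_one hq.ne']
  set q := ((i + a)! : ℝ) / (i ! : ℝ)
  rw [eq_div_of_mul_eq hq.ne' h3.symm]
  constructor
  · calc _ = ‖cf f i 0‖ * (k₁ * q ^ ((b : ℝ) / a)) / q := by ring
      _ ≤ _ := by gcongr
  · calc _ ≤ ‖cf f i 0‖ * (k₂ * q ^ ((b : ℝ) / a)) / q := by gcongr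
      _ = _ := by ring

/-- The step factor is at least a constant times `(i + 1) ^ (b - a)`, which is unbounded as `a < b`.
-/
theorem rapid_growth (ha : 0 < a) (hab : a < b) (hε : ε ≠ 0) (h : IsBasicSolution a b β ε k f)
    (K : ℝ) : ∃ N, ∀ m ≥ N, K * ‖cf f (k + a * m) 0‖ ≤ ‖cf f (k + a * (m + 1)) 0‖ := by
  obtain ⟨k₁, _, N, hk₁, _, hb⟩ := h.step_bounds ha hab hε
  refine ⟨max N ⌈K / k₁⌉₊, fun m hm => ?_⟩
  have hm1 : m ≤ k + a * m := by nlinarith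
  have h1 := (hb (k + a * m) (by omega)).1
  rw [show k + a * (m + 1) = k + a * m + a by ring]
  refine le_trans ?_ h1
  gcongr
  set i := k + a * m
  have hKi : K / k₁ ≤ i := (Nat.le_ceil _).trans (by
    exact_mod_cast ((le_max_right _ _).trans hm).trans hm1)
  rw [div_le_iff₀ hk₁] at hKi
  have h2 : (i : ℝ) ≤ (((i + a)! : ℝ) / i !) ^ ((b : ℝ) / a - 1) := by
    have hba : (0 : ℝ) ≤ (b : ℝ) / a - 1 := by
      rw [sub_nonneg, one_le_div (by positivity)]; exact_mod_cast hab.le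
    have h3 := Real.rpow_le_rpow (by positivity) (factorial_ratio_bounds ha i).1 hba
    refine le_trans ?_ h3
    rw [← Real.rpow_natCast, ← Real.rpow_mul (by positivity),
      show (a : ℝ) * (b / a - 1) = ((b - a : ℕ) : ℝ) by
        rw [Nat.cast_sub hab.le]; field_simp, Real.rpow_natCast]
    have h4 : (i : ℝ) + 1 ≤ (i + 1) ^ (b - a) :=
      le_self_pow₀ (by linarith [(by positivity : (0 : ℝ) ≤ i)]) (by omega)
    linarith
  calc K ≤ i * k₁ := hKi
    _ ≤ _ := by rw [mul_comm]; gcongr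

/-- After division by `(i!) ^ (b / a - 1)` the factorial ratio in `step_bounds` cancels, and each
step multiplies by at most `k₂`. -/
theorem factorial_bound (ha : 0 < a) (hab : a < b) (hε : ε ≠ 0)
    (h : IsBasicSolution a b β ε k f) : ∃ C R : ℝ, 0 ≤ C ∧ 0 < R ∧
      ∀ i, ‖cf f i 0‖ ≤ C * R ^ i * (i ! : ℝ) ^ ((b : ℝ) / a - 1) := by
  obtain ⟨_, k₂, N, _, hk₂, hb⟩ := h.step_bounds ha hab hε
  obtain ⟨C, R, hC, hR, hx⟩ := exists_geometric_bound ha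
    (x := fun i => ‖cf f i 0‖ / (i ! : ℝ) ^ ((b : ℝ) / a - 1)) fun l =>
    ⟨‖cf f (l + a * N) 0‖ / ((l + a * N)! : ℝ) ^ ((b : ℝ) / a - 1), max 1 k₂, N, by positivity,
      le_max_left _ _, fun m hm => by
      induction m, hm using Nat.le_induction with
      | base => exact le_mul_of_one_le_right (by positivity) (one_le_pow₀ (le_max_left _ _))
      | succ m hm ih =>
        have h1 := (hb (l + a * m) (by nlinarith)).2
        rw [show (l : ℕ) + a * (m + 1) = l + a * m + a by ring]
        set i := (l : ℕ) + a * m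
        rw [Real.div_rpow (by positivity) (by positivity)] at h1
        rw [pow_succ, ← mul_assoc]
        calc _ ≤ (k₂ * (((i + a)! : ℝ) ^ ((b : ℝ) / a - 1) / (i ! : ℝ) ^ ((b : ℝ) / a - 1)) *
              ‖cf f i 0‖) / ((i + a)! : ℝ) ^ ((b : ℝ) / a - 1) := by gcongr
          _ = ‖cf f i 0‖ / (i ! : ℝ) ^ ((b : ℝ) / a - 1) * k₂ := by
            have : ((i + a)! : ℝ) ^ ((b : ℝ) / a - 1) ≠ 0 := by positivity
            field_simp
          _ ≤ _ := by
            gcongr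
            exact le_max_right _ _⟩
  refine ⟨C, R, hC, hR, fun i => ?_⟩
  have := hx i
  rwa [div_le_iff₀ (by positivity)] at this

theorem isGevrey (ha : 0 < a) (hab : a < b) (hε : ε ≠ 0) (h : IsBasicSolution a b β ε k f)
    {s : ℝ≥0∞} (hs : (b : ℝ≥0∞) / a ≤ s) : IsGevrey s f := by
  refine ⟨isFormalGerm_of_E ha hε h.isConvergent_E, fun hs' => ?_⟩
  obtain ⟨C, R, hC, hR, hx⟩ := h.factorial_bound ha hab hε
  have hs1 : (b : ℝ) / a ≤ s.toReal := by
    have := ENNReal.toReal_mono hs' hs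
    simpa using this
  have hba : (1 : ℝ) ≤ (b : ℝ) / a := by
    rw [one_le_div (by positivity)]; exact_mod_cast hab.le
  refine isConvergent_rho_of_E ha hε (hba.trans hs1) h.isConvergent_E hC hR fun i =>
    (hx i).trans ?_
  gcongr
  exact_mod_cast Nat.factorial_pos i

/-- The normalised sequence decays at most geometrically, so a nonzero `A` would bound `(i!) ^ (b /
a - s)` geometrically. -/
theorem eq_zero_of_gevrey_bound (ha : 0 < a) (hab : a < b) (hε : ε ≠ 0)
    (h : IsBasicSolution a b β ε k f) {s : ℝ} (hs : s < (b : ℝ) / a) {A : ℂ} {C R : ℝ} {M : ℕ}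
    (hC : 0 ≤ C) (hR : 0 < R) (hA : ∀ m ≥ M,
      ‖A * cf f (k + a * m) 0‖ ≤ C * R ^ m * ((k + a * m)! : ℝ) ^ (s - 1)) : A = 0 := by
  by_contra hA0
  obtain ⟨k₁, _, N, hk₁, _, hb⟩ := h.step_bounds ha hab hε
  obtain ⟨N', hN'⟩ := h.ne_zero
  set L := max N N'
  set τ := (b : ℝ) / a - 1 with hτ
  set x : ℕ → ℝ := fun m => ‖cf f (k + a * m) 0‖ / ((k + a * m)! : ℝ) ^ τ with hx
  have hx0 : 0 < x L := div_pos (norm_pos_iff.2 (hN' _ (le_max_right _ _))) (by positivity)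
  have hstep : ∀ m ≥ L, k₁ * x m ≤ x (m + 1) := fun m hm => by
    have h1 := (hb (k + a * m) (by
      have : m ≤ a * m := Nat.le_mul_of_pos_left m ha
      have := (le_max_left N N').trans hm
      omega)).1
    simp only [hx]
    rw [show k + a * (m + 1) = k + a * m + a by ring]
    set i := k + a * m
    rw [Real.div_rpow (by positivity) (by positivity)] at h1
    rw [le_div_iff₀ (by positivity)]
    refine le_trans (le_of_eq ?_) h1
    ring
  have hlow : ∀ j, k₁ ^ j * x L ≤ x (L + j) := fun j => by
    induction j with
    | zero => simp
    | succ j ih =>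
      calc _ = k₁ * (k₁ ^ j * x L) := by ring
        _ ≤ k₁ * x (L + j) := by gcongr
        _ ≤ _ := hstep _ (Nat.le_add_right _ _)
  have hApos : 0 < ‖A‖ := norm_pos_iff.2 hA0
  -- Chosen so that the comparison at `j` becomes `(C + 1) * R ^ (L + j) < C * R ^ (L + j)`; `C + 1`
  -- also keeps `D` positive when `C = 0`.
  set D := (C + 1) * R ^ L / (‖A‖ * x L)
  obtain ⟨j, hj, hlt⟩ := exists_lt_factorial_rpow (sub_pos.2 hs) (D := D) (T := R / k₁)
    (by positivity) (by positivity) M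
  have h1 := hA (L + j) (by omega)
  have h2 := hlow j
  simp only [hx] at h2
  set i := k + a * (L + j)
  have hji : j ≤ i := by
    have : L + j ≤ a * (L + j) := Nat.le_mul_of_pos_left _ ha
    omega
  have hw : (0 : ℝ) < (i ! : ℝ) ^ (s - 1) := by positivity
  rw [le_div_iff₀ (by positivity)] at h2
  rw [norm_mul] at h1
  have hτs : (i ! : ℝ) ^ τ = (i ! : ℝ) ^ ((b : ℝ) / a - s) * (i ! : ℝ) ^ (s - 1) := by
    rw [← Real.rpow_add (by positivity)]; congr 1; rw [hτ]; ring
  have h3 : ‖A‖ * (k₁ ^ j * x L * (i ! : ℝ) ^ ((b : ℝ) / a - s)) ≤ C * R ^ (L + j) := by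
    refine le_of_mul_le_mul_right ?_ hw
    calc _ = ‖A‖ * (k₁ ^ j * x L * (i ! : ℝ) ^ τ) := by rw [hτs]; ring
      _ ≤ ‖A‖ * ‖cf f i 0‖ := by gcongr
      _ ≤ _ := h1
  have h4 : (j ! : ℝ) ^ ((b : ℝ) / a - s) ≤ (i ! : ℝ) ^ ((b : ℝ) / a - s) := by
    have := Nat.factorial_le hji
    gcongr
  have h5 : D * (R / k₁) ^ j * (‖A‖ * (k₁ ^ j * x L)) = (C + 1) * R ^ (L + j) := by
    simp only [D]
    rw [div_pow, pow_add]
    field_simp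
  have h6 : D * (R / k₁) ^ j * (‖A‖ * (k₁ ^ j * x L)) <
      (i ! : ℝ) ^ ((b : ℝ) / a - s) * (‖A‖ * (k₁ ^ j * x L)) :=
    mul_lt_mul_of_pos_right (hlt.trans_le h4) (by positivity)
  have h7 : 0 < R ^ (L + j) := by positivity
  nlinarith

/-- A series with `E • g` and `P • g` convergent is, on the exponents `i ≡ k`, congruent to a
multiple of a basic solution. -/
theorem exists_congr (ha : 0 < a) (hab : a < b) (hε : ε ≠ 0)
    (h : IsBasicSolution a b β ε k f) {g : FormalSeries} (hE : IsConvergent (E a b β ε • g))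
    (hP : IsConvergent (P a b • g)) : ∃ A : ℂ, ∃ C R : ℝ, ∃ N : ℕ, 0 ≤ C ∧ 1 ≤ R ∧
      ∀ m ≥ N, ‖cf g (k + a * m) 0 - A * cf f (k + a * m) 0‖ ≤ C * R ^ m := by
  obtain ⟨C, R, hC, hR, hd⟩ := exists_recurrence_error_bound ha hε hE hP
  obtain ⟨N, hN⟩ := h.recurrence
  obtain ⟨N', hN'⟩ := h.ne_zero
  have hle : ∀ m, m ≤ k + a * m := fun m => by
    have : m ≤ a * m := Nat.le_mul_of_pos_left m ha
    omega
  have hsucc : ∀ m, k + a * (m + 1) = k + a * m + a := fun m => by ring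
  -- The substitution `i = k + a m` turns the bound `C * R ^ i` into `(C * R ^ k) * (R ^ a) ^ m`.
  obtain ⟨A, M, hA⟩ := exists_norm_sub_mul_le (e := fun m => cf g (k + a * m) 0)
    (h := fun m => cf f (k + a * m) 0) (r := fun m => indicial a b β ε (k + a * m))
    (s := fun m => ((k + a * m + a)! / (k + a * m)! : ℂ)) (N := max N N')
    (d := fun m => cf g (k + a * m) 0 * indicial a b β ε (k + a * m) -
      cf g (k + a * m + a) 0 * ((k + a * m + a)! / (k + a * m)! : ℂ)) (C := C * R ^ k)
    (R := R ^ a)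
    (fun m => by
      rw [norm_div, Complex.norm_natCast, Complex.norm_natCast, one_le_div (by positivity)]
      exact_mod_cast Nat.factorial_le (Nat.le_add_right _ _))
    (fun m => by simp only [hsucc]; ring)
    (fun m hm => by
      simp only [hsucc]; exact hN _ (((le_max_left _ _).trans hm).trans (hle m)))
    (fun m hm => hN' m ((le_max_right _ _).trans hm))
    (h.rapid_growth ha hab hε) (by positivity) (one_le_pow₀ hR)
    (fun m => by
      rw [← pow_mul, mul_assoc, ← pow_add]; exact hd _)
  exact ⟨A, C * R ^ k, R ^ a, M, by positivity, one_le_pow₀ hR, hA⟩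

end IsBasicSolution

/-! ### `ℰxt⁰` as a space of classes of series -/

section Ext

variable {a b : ℕ} {β ε : ℂ} {s : ℝ≥0∞} {hs : 1 ≤ s}

theorem quotient_mk_eq_smul_one (T : DiffOp) :
    (Submodule.Quotient.mk T : M a b β ε) = T • Submodule.Quotient.mk (1 : DiffOp) := by
  rw [← Submodule.Quotient.mk_smul, smul_eq_mul, mul_one]

theorem Ext0.ext_one {u v : Ext0 a b β ε s hs}
    (h : u (Submodule.Quotient.mk 1) = v (Submodule.Quotient.mk 1)) : u = v := by
  refine LinearMap.ext fun x => ?_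
  obtain ⟨T, rfl⟩ := Submodule.Quotient.mk_surjective _ x
  rw [quotient_mk_eq_smul_one, map_smul, map_smul, h]

theorem QY.mk_eq_zero_iff (f : Gevrey s hs) :
    (Submodule.Quotient.mk f : QY s hs) = 0 ↔ IsConvergent (f : FormalSeries) := by
  rw [Submodule.Quotient.mk_eq_zero]
  rfl

/-- The map `T ↦ T • [f]` descends to the quotient because it kills both generators of the ideal. -/
theorem exists_isClassOf {f : FormalSeries} (hf : IsGevrey s f)
    (hE : IsConvergent (E a b β ε • f)) (hP : IsConvergent (P a b • f)) :
    ∃ u : Ext0 a b β ε s hs, IsClassOf u f := by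
  let f' : Gevrey s hs := ⟨f, hf⟩
  refine ⟨Submodule.liftQ _ (LinearMap.toSpanSingleton DiffOp (QY s hs)
    (Submodule.Quotient.mk f')) (Submodule.span_le.2 ?_), hf, ?_⟩
  · rintro T (rfl | rfl)
    · exact (QY.mk_eq_zero_iff (P a b • f')).2 hP
    · exact (QY.mk_eq_zero_iff (E a b β ε • f')).2 hE
  · exact (Submodule.liftQ_apply _ _ _).trans (one_smul _ _)

theorem exists_series (u : Ext0 a b β ε s hs) :
    ∃ f, IsClassOf u f ∧ IsConvergent (E a b β ε • f) ∧ IsConvergent (P a b • f) := by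
  obtain ⟨f, hf⟩ := Submodule.Quotient.mk_surjective _ (u (Submodule.Quotient.mk 1))
  have key : ∀ T ∈ ({P a b, E a b β ε} : Set DiffOp),
      IsConvergent (T • (f : FormalSeries)) := fun T hT => by
    refine (QY.mk_eq_zero_iff (hs := hs) (T • f)).1 ?_
    rw [Submodule.Quotient.mk_smul, hf, ← map_smul, ← quotient_mk_eq_smul_one,
      (Submodule.Quotient.mk_eq_zero _).2 (Submodule.subset_span hT), map_zero]
  exact ⟨f, ⟨f.2, hf.symm⟩, key _ (by simp), key _ (by simp)⟩

namespace IsClassOf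

theorem sub {u v : Ext0 a b β ε s hs} {f g : FormalSeries} (hu : IsClassOf u f)
    (hv : IsClassOf v g) : IsClassOf (u - v) (f - g) := by
  obtain ⟨hf, hu⟩ := hu
  obtain ⟨hg, hv⟩ := hv
  exact ⟨Submodule.sub_mem _ hf hg, by rw [LinearMap.sub_apply, hu, hv]; rfl⟩

theorem smul (c : ℂ) {u : Ext0 a b β ε s hs} {f : FormalSeries} (hu : IsClassOf u f) :
    IsClassOf (c • u) (c • f) := by
  obtain ⟨hf, hu⟩ := hu
  exact ⟨Submodule.smul_of_tower_mem _ c hf, by rw [LinearMap.smul_apply, hu]; rfl⟩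

theorem zero : IsClassOf (0 : Ext0 a b β ε s hs) 0 :=
  ⟨Submodule.zero_mem _, rfl⟩

theorem add {u v : Ext0 a b β ε s hs} {f g : FormalSeries} (hu : IsClassOf u f)
    (hv : IsClassOf v g) : IsClassOf (u + v) (f + g) := by
  obtain ⟨hf, hu⟩ := hu
  obtain ⟨hg, hv⟩ := hv
  exact ⟨Submodule.add_mem _ hf hg, by rw [LinearMap.add_apply, hu, hv]; rfl⟩

theorem sum {ι : Type*} (t : Finset ι) {u : ι → Ext0 a b β ε s hs} {f : ι → FormalSeries}
    (h : ∀ k, IsClassOf (u k) (f k)) : IsClassOf (∑ k ∈ t, u k) (∑ k ∈ t, f k) := by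
  classical
  induction t using Finset.induction_on with
  | empty => exact zero
  | insert k t hk ih =>
    rw [Finset.sum_insert hk, Finset.sum_insert hk]
    exact (h k).add ih

/-- Turns linear relations in `Ext0` into convergence of the corresponding combinations of series.
-/
theorem eq_zero_iff {u : Ext0 a b β ε s hs} {f : FormalSeries} (hu : IsClassOf u f) :
    u = 0 ↔ IsConvergent f := by
  obtain ⟨hf, hu⟩ := hu
  rw [← QY.mk_eq_zero_iff (hs := hs) ⟨f, hf⟩, ← hu]
  exact ⟨fun h => by rw [h]; rfl, fun h => Ext0.ext_one (h.trans rfl)⟩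

end IsClassOf

end Ext

/-! ### Bases of `ℰxt⁰` -/

section Family

variable {a b : ℕ} {β ε : ℂ} {f : Fin a → FormalSeries}

/-- On the line `t₁ = 0` the members of the family have disjoint supports, so each residue class
sees one constant. -/
theorem cf_sum_family (hf : ∀ k : Fin a, IsBasicSolution a b β ε k (f k)) (A : Fin a → ℂ) (k : Fin a)
    (m : ℕ) :
    cf (∑ l, A l • f l) (k + a * m) 0 = A k * cf (f k) (k + a * m) 0 := by
  rw [cf_sum, Finset.sum_eq_single k, cf_smul]
  · intro l _ hl
    rw [cf_smul, (hf l).support, mul_zero]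
    rw [Nat.add_mul_mod_self_left, Nat.mod_eq_of_lt k.2]
    exact fun h => hl (Fin.ext h.symm)
  · simp

theorem exists_isConvergent_sub (ha : 0 < a) (hab : a < b) (hε : ε ≠ 0)
    (hf : ∀ k : Fin a, IsBasicSolution a b β ε k (f k)) {g : FormalSeries}
    (hE : IsConvergent (E a b β ε • g)) (hP : IsConvergent (P a b • g)) :
    ∃ A : Fin a → ℂ, IsConvergent (g - ∑ k, A k • f k) := by
  choose A C R N hC hR hA using fun k => (hf k).exists_congr ha hab hε hE hP
  refine ⟨A, ?_⟩
  have hEs : E a b β ε • ∑ k, A k • f k = 0 := by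
    rw [DiffOp.smul_def, map_sum]
    refine Finset.sum_eq_zero fun k _ => ?_
    rw [map_smul, ← DiffOp.smul_def, (hf k).E_smul, smul_zero]
  obtain ⟨D, S, hD, hS, hx⟩ := exists_geometric_bound ha
    (x := fun i => ‖cf g i 0 - cf (∑ k, A k • f k) i 0‖) fun k =>
    ⟨C k, R k, N k, hC k, hR k, fun m hm => by rw [cf_sum_family hf]; exact hA k m hm⟩
  exact isConvergent_sub ha hε hE (hEs ▸ Holo.zero_mem) hD hS hx

/-- Serves twice: with `s = 1` for linear independence, and with `s < b / a` for the vanishing of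
`Ext0`. -/
theorem eq_zero_of_isConvergent_rho (ha : 0 < a) (hab : a < b) (hε : ε ≠ 0)
    (hf : ∀ k : Fin a, IsBasicSolution a b β ε k (f k)) {A : Fin a → ℂ} {s : ℝ} (hs : s < (b : ℝ) / a)
    (h : IsConvergent (rho s (∑ k, A k • f k))) (k : Fin a) : A k = 0 := by
  obtain ⟨C, R, hC, hR, h⟩ := (isConvergent_rho_iff _ _).1 h
  refine (hf k).eq_zero_of_gevrey_bound ha hab hε hs (C := C * R ^ (k : ℕ)) (R := R ^ a) (M := 0)
    (by positivity) (by positivity) fun m _ => ?_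
  have := h (k + a * m) 0
  rw [cf_sum_family hf] at this
  rwa [← pow_mul, mul_assoc C, ← pow_add]

theorem exists_basis (ha : 0 < a) (hab : a < b) (hε : ε ≠ 0)
    (hf : ∀ k : Fin a, IsBasicSolution a b β ε k (f k)) {s : ℝ≥0∞} (hs : 1 ≤ s)
    (hsb : (b : ℝ≥0∞) / a ≤ s) :
    ∃ B : Module.Basis (Fin a) ℂ (Ext0 a b β ε s hs), ∀ k, IsClassOf (B k) (f k) := by
  choose u hu using fun k => exists_isClassOf (hs := hs) ((hf k).isGevrey ha hab hε hsb)
    (hf k).isConvergent_E ((hf k).isConvergent_P ha hε)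
  have hsum : ∀ A : Fin a → ℂ, IsClassOf (∑ k, A k • u k) (∑ k, A k • f k) := fun A =>
    IsClassOf.sum _ fun k => (hu k).smul (A k)
  have hli : LinearIndependent ℂ u := Fintype.linearIndependent_iff.2 fun A hA => by
    refine eq_zero_of_isConvergent_rho ha hab hε hf (s := 1) ?_ ?_
    · rw [one_lt_div (by positivity)]; exact_mod_cast hab
    · rw [rho_one]; exact (hsum A).eq_zero_iff.1 hA
  have hsp : ⊤ ≤ Submodule.span ℂ (Set.range u) := fun v _ => by
    obtain ⟨g, hg, hE, hP⟩ := exists_series v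
    obtain ⟨A, hA⟩ := exists_isConvergent_sub ha hab hε hf hE hP
    rw [sub_eq_zero.1 ((hg.sub (hsum A)).eq_zero_iff.2 hA)]
    exact Submodule.sum_mem _ fun k _ =>
      Submodule.smul_mem _ _ (Submodule.subset_span ⟨k, rfl⟩)
  exact ⟨Module.Basis.mk hli hsp, fun k => by rw [Module.Basis.mk_apply]; exact hu k⟩

theorem subsingleton_ext (ha : 0 < a) (hab : a < b) (hε : ε ≠ 0)
    (hf : ∀ k : Fin a, IsBasicSolution a b β ε k (f k)) {s : ℝ≥0∞} (hs : 1 ≤ s)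
    (hsb : s < (b : ℝ≥0∞) / a) : Subsingleton (Ext0 a b β ε s hs) := by
  refine subsingleton_of_forall_eq 0 fun v => ?_
  obtain ⟨g, hg, hE, hP⟩ := exists_series v
  obtain ⟨A, hA⟩ := exists_isConvergent_sub ha hab hε hf hE hP
  have hs' : s ≠ ⊤ := hsb.ne_top
  have hsR : s.toReal < (b : ℝ) / a := by
    have := (ENNReal.toReal_lt_toReal hs' (ENNReal.div_ne_top (ENNReal.natCast_ne_top b)
      (by exact_mod_cast ha.ne'))).2 hsb
    simpa using this
  have hs1 : 1 ≤ s.toReal := by simpa using ENNReal.toReal_mono hs' hs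
  -- The combination of basic solutions differs from `g` by a convergent series, hence is itself
  -- Gevrey of order `s`.
  have hgev : IsGevrey s (g - (g - ∑ k, A k • f k)) :=
    (Gevrey s hs).sub_mem hg.1 ⟨((isGevrey_one_iff _).2 hA).1, fun _ => by
      obtain ⟨C, R, hC, hR, h⟩ := (isConvergent_iff _).1 hA
      refine (isConvergent_rho_iff _ _).2 ⟨C, R, hC, hR, fun i j => (h i j).trans ?_⟩
      exact le_mul_of_one_le_right (by positivity)
        (Real.one_le_rpow (by exact_mod_cast Nat.factorial_pos i) (by linarith))⟩
  rw [sub_sub_cancel] at hgev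
  have hA0 := eq_zero_of_isConvergent_rho ha hab hε hf hsR (hgev.2 hs')
  simp only [hA0, zero_smul, Finset.sum_const_zero, sub_zero] at hA
  exact hg.eq_zero_iff.2 hA

end Family

/-! ### The `Γ`-series are basic solutions -/

theorem poch_add (z : ℂ) (m n : ℕ) : poch z (m + n) = poch z m * poch (z - m) n := by
  rw [poch, Finset.prod_range_add, poch, poch]
  congr 1
  exact Finset.prod_congr rfl fun j _ => by push_cast; ring

theorem poch_ne_zero {z : ℂ} (hz : ∀ j : ℕ, z ≠ j) (n : ℕ) : poch z n ≠ 0 :=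
  Finset.prod_ne_zero_iff.2 fun j _ => sub_ne_zero.2 (hz j)

theorem poch_natCast_add (n m : ℕ) : poch ((n : ℂ) + m) m = ((n + m)! / n ! : ℂ) := by
  have hn : ((n ! : ℕ) : ℂ) ≠ 0 := by exact_mod_cast Nat.factorial_ne_zero n
  rw [eq_div_iff hn]
  induction m with
  | zero => simp [poch]
  | succ m ih =>
    have h := poch_add ((n : ℂ) + (m + 1 : ℕ)) 1 m
    rw [show (n : ℂ) + (m + 1 : ℕ) - (1 : ℕ) = n + m by push_cast; ring] at h
    rw [add_comm 1 m] at h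
    rw [h, mul_assoc, ih, ← add_assoc, Nat.factorial_succ]
    simp only [poch, Finset.prod_range_one]
    push_cast
    ring

/-- As the second exponent is a natural number, the denominator is `(n + r)! / n!`, and the
exceptional value 0 of `Gam` never occurs here. -/
theorem Gam_eq (γ : ℂ) (n p r : ℕ) :
    Gam (γ, n) (-(p : ℤ), (r : ℤ)) = poch γ p * n ! / (n + r)! := by
  have hn : ((n ! : ℕ) : ℂ) ≠ 0 := by exact_mod_cast Nat.factorial_ne_zero n
  have hnr : (((n + r)! : ℕ) : ℂ) ≠ 0 := by exact_mod_cast Nat.factorial_ne_zero (n + r)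
  have h : poch2 (γ + (-(p : ℤ) : ℤ), (n : ℂ) + (r : ℤ)) ((-(p : ℤ)).toNat, (r : ℤ).toNat) =
      ((n + r)! / n ! : ℂ) := by
    simp [poch2, poch, ← poch_natCast_add]
  simp only [Gam]
  rw [h, if_pos (div_ne_zero hnr hn)]
  simp [poch2, poch]
  field_simp

section GammaSeries

variable {a b : ℕ} {ε l γ : ℂ} {n c : ℕ}

theorem cf_gammaSeries_of_ne {i : ℕ} (h : ∀ m, n + a * m = i → ¬ c ≤ b * m) (j : ℕ) :
    cf (gammaSeries a b ε l γ n c) i j = 0 := by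
  rw [gammaSeries, cf_mk, Finset.filter_false_of_mem, Finset.sum_empty, map_zero]
  exact fun m _ hm => h m hm.1 hm.2

theorem cf_gammaSeries (ha : 0 < a) {m : ℕ} (h : c ≤ b * m) (j : ℕ) :
    cf (gammaSeries a b ε l γ n c) (n + a * m) j =
      poch γ (b * m) * n ! / (n + a * m)! *
        (Complex.exp ((γ - b * m) * l) * poch (γ - b * m) j / (j ! * ε ^ j)) := by
  have hfilter : (Finset.range (n + a * m + 1)).filter
      (fun m' => n + a * m' = n + a * m ∧ c ≤ b * m') = {m} := by
    ext m'
    simp only [Finset.mem_filter, Finset.mem_range, Finset.mem_singleton, add_right_inj]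
    constructor
    · exact fun h' => Nat.eq_of_mul_eq_mul_left ha h'.2.1
    · rintro rfl
      have := Nat.le_mul_of_pos_left m' ha
      exact ⟨by omega, rfl, h⟩
  have hGam := Gam_eq γ n (b * m) (a * m)
  push_cast at hGam
  rw [gammaSeries, cf_mk, hfilter, Finset.sum_singleton, PowerSeries.coeff_smul, powSeries,
    PowerSeries.coeff_mk, smul_eq_mul, hGam]

/-- The recurrence is `(γ)_{b(m+1)} = (γ)_{bm} (γ - b m)_b`, with `ε ^ b` from the shift of the
exponent of `x₁`. Since `γ` is not a natural number, no Pochhammer factor vanishes and the series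
never terminates. The cutoff `c` affects only finitely many indices. -/
theorem isBasicSolution_gammaSeries (ha : 0 < a) (hb : 0 < b) (hε : Complex.exp l = ε) {β : ℂ}
    (hγ : a * γ = β - b * n) (hγn : ∀ j : ℕ, γ ≠ j) :
    IsBasicSolution a b β ε (n % a) (gammaSeries a b ε l γ n c) := by
  have ha' : (a : ℂ) ≠ 0 := by exact_mod_cast ha.ne'
  have hε0 : ε ≠ 0 := hε ▸ Complex.exp_ne_zero l
  set f := gammaSeries a b ε l γ n c with hf
  have hexp : ∀ i, (∃ m, c ≤ b * m ∧ n + a * m = i) ∨ ∀ m, n + a * m = i → ¬ c ≤ b * m := fun i => by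
    by_cases h : ∃ m, c ≤ b * m ∧ n + a * m = i
    · exact Or.inl h
    · push Not at h
      exact Or.inr fun m hm hc => h m hc hm
  have hγm : ∀ m : ℕ, (β - b * (n + a * m : ℕ)) / a = γ - b * m := fun m => by
    rw [div_eq_iff ha']; push_cast; linear_combination -hγ
  have hne : ∀ m, c ≤ b * m → cf f (n + a * m) 0 ≠ 0 := fun m hm => by
    rw [hf, cf_gammaSeries ha hm]
    have h1 : ((n ! : ℕ) : ℂ) ≠ 0 := by exact_mod_cast Nat.factorial_ne_zero n
    have h2 : (((n + a * m)! : ℕ) : ℂ) ≠ 0 := by exact_mod_cast Nat.factorial_ne_zero (n + a * m)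
    have h3 := poch_ne_zero hγn (b * m)
    have h4 := Complex.exp_ne_zero ((γ - b * m) * l)
    refine mul_ne_zero (div_ne_zero (mul_ne_zero h3 h1) h2) ?_
    simp [poch, h4]
  -- Past `n + a * c` every exponent `n + a m` has `m ≥ c`, hence `b m ≥ c`. The second threshold `n
  -- + c` also allows for the shift by `n / a` when counting from `n % a` instead of `n`.
  refine ⟨?_, fun i hi => ?_, ⟨n + a * c, fun i hi => ?_⟩, ⟨n + c, fun m hm => ?_⟩⟩
  · ext i j
    rw [cf_E, cf_zero]
    rcases hexp i with ⟨m, hm, rfl⟩ | h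
    · have hj : ((j ! : ℕ) : ℂ) ≠ 0 := by exact_mod_cast Nat.factorial_ne_zero j
      have hj' : ((j : ℂ) + 1) ≠ 0 := by exact_mod_cast Nat.succ_ne_zero j
      have h2 : (((n + a * m)! : ℕ) : ℂ) ≠ 0 := by
        exact_mod_cast Nat.factorial_ne_zero (n + a * m)
      have hβ : β = a * γ + b * n := by rw [hγ]; ring
      rw [hf, cf_gammaSeries ha hm, cf_gammaSeries ha hm, poch_add _ j 1, Nat.factorial_succ, hβ]
      simp only [poch, Finset.prod_range_one]
      push_cast
      field_simp
      ring
    · rw [hf, cf_gammaSeries_of_ne h, cf_gammaSeries_of_ne h]; ring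
  · refine cf_gammaSeries_of_ne (fun m hm => absurd ?_ hi) 0
    rw [← hm, Nat.add_mul_mod_self_left]
  · by_cases hmod : ∃ m, n + a * m = i
    · obtain ⟨m, rfl⟩ := hmod
      have hcm : c ≤ b * m := by
        have : c ≤ m := Nat.le_of_mul_le_mul_left (by omega : a * c ≤ a * m) ha
        exact this.trans (Nat.le_mul_of_pos_left m hb)
      have hcm' : c ≤ b * (m + 1) := hcm.trans (Nat.mul_le_mul_left b (Nat.le_succ m))
      have h1 : (((n + a * m)! : ℕ) : ℂ) ≠ 0 := by
        exact_mod_cast Nat.factorial_ne_zero (n + a * m)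
      have h2 : (((n + a * m + a)! : ℕ) : ℂ) ≠ 0 := by
        exact_mod_cast Nat.factorial_ne_zero (n + a * m + a)
      have he : Complex.exp ((γ - b * (m + 1 : ℕ)) * l) * ε ^ b =
          Complex.exp ((γ - b * m) * l) := by
        rw [← hε, ← Complex.exp_nat_mul, ← Complex.exp_add]
        congr 1; push_cast; ring
      rw [show n + a * m + a = n + a * (m + 1) by ring] at h2 ⊢
      rw [indicial, hγm, hf, cf_gammaSeries ha hcm, cf_gammaSeries ha hcm', mul_add b m 1, mul_one,
        poch_add γ (b * m) b, ← he]
      simp [poch]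
      field_simp
    · push Not at hmod
      rw [hf, cf_gammaSeries_of_ne (fun m hm => absurd hm (hmod m)), cf_gammaSeries_of_ne]
      · simp
      -- The index `i + a` cannot be the first exponent `n`, because `i ≥ n`.
      · intro m hm
        cases m with
        | zero => have := Nat.le_mul_of_pos_left c ha; omega
        | succ m => exact absurd (by rw [mul_add] at hm; omega) (hmod m)
  · have hn := Nat.mod_add_div n a
    have hle : n / a ≤ m := (Nat.div_le_self n a).trans (by omega)
    have hc : c ≤ m - n / a := by have := Nat.div_le_self n a; omega
    have h : n % a + a * m = n + a * (m - n / a) := by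
      have : a * m = a * (n / a) + a * (m - n / a) := by rw [← mul_add, Nat.add_sub_cancel' hle]
      omega
    rw [h]
    exact hne _ (hc.trans (Nat.le_mul_of_pos_left _ hb))

end GammaSeries

theorem isBasicSolution_phi {a b : ℕ} (ha : 0 < a) (hb : 0 < b) {β ε l : ℂ}
    (hε : Complex.exp l = ε) {k : ℕ} (hk : k < a) (hβ : ¬ ∃ m : ℕ, β = k * b + a * m) :
    IsBasicSolution a b β ε k (phi a b β ε l k) := by
  have ha' : (a : ℂ) ≠ 0 := by exact_mod_cast ha.ne'
  have h := isBasicSolution_gammaSeries (c := 0) ha hb hε (β := β) (n := k)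
    (γ := (β - k * b) / a) (by rw [mul_div_cancel₀ _ ha']; ring) fun j hj => hβ ⟨j, by
      rw [div_eq_iff ha'] at hj; linear_combination hj⟩
  rwa [Nat.mod_eq_of_lt hk] at h

/-- The exponent `m₀ - b m'` of `x₁` is a negative integer by the choice of `m'`, so nontermination
is automatic. -/
theorem isBasicSolution_phiTilde {a b : ℕ} (ha : 0 < a) (hb : 0 < b) {β ε l : ℂ}
    (hε : Complex.exp l = ε) {q m₀ : ℕ} (hq : q < a) (hβ : β = q * b + a * m₀) :
    IsBasicSolution a b β ε q (phiTilde a b ε l q m₀) := by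
  have hm : m₀ + 1 ≤ b * mPrime b m₀ :=
    Nat.sInf_mem (s := {m : ℕ | m₀ + 1 ≤ b * m}) ⟨m₀ + 1, Nat.le_mul_of_pos_left _ hb⟩
  have h := isBasicSolution_gammaSeries (c := m₀ + 1) ha hb hε (β := β)
    (n := q + a * mPrime b m₀) (γ := (m₀ : ℂ) - b * mPrime b m₀)
    (by rw [hβ]; push_cast; ring) fun j hj => by
      have : m₀ = j + b * mPrime b m₀ := by
        have h1 : (m₀ : ℂ) = j + b * mPrime b m₀ := by linear_combination hj
        exact_mod_cast h1
      omega
  rwa [Nat.add_mul_mod_self_left, Nat.mod_eq_of_lt hq] at h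

/-- If `β ∈ aℕ + bℕ`, exactly one residue `q` modulo `a` satisfies `β ∈ q b + aℕ`. -/
theorem exists_unique_residue {a b : ℕ} (ha : 0 < a) (hcop : Nat.Coprime a b) {β : ℂ}
    (hβ : ∃ i j : ℕ, β = a * i + b * j) :
    ∃ q : Fin a, (∃ m₀ : ℕ, β = q * b + a * m₀) ∧
      ∀ k : Fin a, (∃ m : ℕ, β = k * b + a * m) → k = q := by
  obtain ⟨i, j, rfl⟩ := hβ
  refine ⟨⟨j % a, Nat.mod_lt j ha⟩, ⟨i + b * (j / a), ?_⟩, fun k ⟨m, hm⟩ => Fin.ext ?_⟩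
  · have h : ((j % a + a * (j / a) : ℕ) : ℂ) = j := by rw [Nat.mod_add_div]
    push_cast at h ⊢
    linear_combination -(b : ℂ) * h
  · have h : a * i + b * j = k * b + a * m := by exact_mod_cast hm
    have hmod : b * j ≡ b * k [MOD a] := by
      have h1 : (a * i + b * j) % a = (k * b + a * m) % a := by rw [h]
      rwa [Nat.mul_add_mod, Nat.add_mul_mod_self_left, mul_comm (k : ℕ)] at h1
    have h2 := Nat.ModEq.cancel_left_of_coprime hcop hmod
    rw [← Nat.mod_eq_of_lt k.2]
    exact h2.symm

end GKZ

/-! ### Dimension and explicit bases -/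

theorem mainTheorem1 (a b : ℕ) (ha : 0 < a) (hab : a < b) (hcop : Nat.Coprime a b)
    (β ε : ℂ) (hε : ε ≠ 0) (s : ℝ≥0∞) (hs : 1 ≤ s) :
    ((b : ℝ≥0∞) / a ≤ s → Module.rank ℂ (GKZ.Ext0 a b β ε s hs) = a) ∧
    (s < (b : ℝ≥0∞) / a → Module.rank ℂ (GKZ.Ext0 a b β ε s hs) = 0) ∧
    ((b : ℝ≥0∞) / a ≤ s → ∀ l : ℂ, Complex.exp l = ε →
      ((¬ ∃ i j : ℕ, β = a * i + b * j) →
        ∃ B : Module.Basis (Fin a) ℂ (GKZ.Ext0 a b β ε s hs),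
          ∀ k : Fin a, GKZ.IsClassOf (B k) (GKZ.phi a b β ε l k)) ∧
      ((∃ i j : ℕ, β = a * i + b * j) →
        ∃ q : Fin a, (∃ m₀ : ℕ, β = q * b + a * m₀) ∧
          (∀ k : Fin a, (∃ m : ℕ, β = k * b + a * m) → k = q) ∧
          ∀ m₀ : ℕ, β = q * b + a * m₀ →
            ∃ B : Module.Basis (Fin a) ℂ (GKZ.Ext0 a b β ε s hs),
              (∀ k : Fin a, k ≠ q → GKZ.IsClassOf (B k) (GKZ.phi a b β ε l k)) ∧
              GKZ.IsClassOf (B q) (GKZ.phiTilde a b ε l q m₀))) := by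
  have hb : 0 < b := ha.trans hab
  have family : ∀ l : ℂ, Complex.exp l = ε →
      ((¬ ∃ i j : ℕ, β = a * i + b * j) →
        ∀ k : Fin a, GKZ.IsBasicSolution a b β ε k (GKZ.phi a b β ε l k)) ∧
      ((∃ i j : ℕ, β = a * i + b * j) →
        ∃ q : Fin a, (∃ m₀ : ℕ, β = q * b + a * m₀) ∧
          (∀ k : Fin a, (∃ m : ℕ, β = k * b + a * m) → k = q) ∧
          ∀ m₀ : ℕ, β = q * b + a * m₀ →
            (∀ k : Fin a, k ≠ q → GKZ.IsBasicSolution a b β ε k (GKZ.phi a b β ε l k)) ∧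
              GKZ.IsBasicSolution a b β ε q (GKZ.phiTilde a b ε l q m₀)) := by
    intro l hl
    refine ⟨fun hβ k => GKZ.isBasicSolution_phi ha hb hl k.2 fun ⟨m, hm⟩ =>
      hβ ⟨m, k, by rw [hm]; ring⟩, ?_⟩
    intro hβ
    obtain ⟨q, hq, huniq⟩ := GKZ.exists_unique_residue ha hcop hβ
    exact ⟨q, hq, huniq, fun m₀ hm₀ =>
      ⟨fun k hk => GKZ.isBasicSolution_phi ha hb hl k.2 fun h => hk (huniq k h),
        GKZ.isBasicSolution_phiTilde ha hb hl q.2 hm₀⟩⟩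
  have modified : ∀ l : ℂ, ∀ q : Fin a, ∀ m₀ : ℕ,
      (∀ k : Fin a, k ≠ q → GKZ.IsBasicSolution a b β ε k (GKZ.phi a b β ε l k)) →
      GKZ.IsBasicSolution a b β ε q (GKZ.phiTilde a b ε l q m₀) →
      ∀ k : Fin a, GKZ.IsBasicSolution a b β ε k
        (if k = q then GKZ.phiTilde a b ε l q m₀ else GKZ.phi a b β ε l k) := by
    intro l q m₀ h1 h2 k
    split_ifs with hk
    · rw [hk]; exact h2
    · exact h1 k hk
  -- The dimension involves no branch, so any family will do; the principal logarithm of `ε`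
  -- supplies one.
  obtain ⟨f, hf⟩ : ∃ f : Fin a → GKZ.FormalSeries,
      ∀ k : Fin a, GKZ.IsBasicSolution a b β ε k (f k) := by
    by_cases hβ : ∃ i j : ℕ, β = a * i + b * j
    · obtain ⟨q, ⟨m₀, hm₀⟩, -, h⟩ := (family _ (Complex.exp_log hε)).2 hβ
      exact ⟨_, modified _ q m₀ (h m₀ hm₀).1 (h m₀ hm₀).2⟩
    · exact ⟨_, (family _ (Complex.exp_log hε)).1 hβ⟩
  refine ⟨fun hsb => ?_, fun hsb => ?_, fun hsb l hl => ⟨fun hβ => ?_, fun hβ => ?_⟩⟩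
  · obtain ⟨B, -⟩ := GKZ.exists_basis ha hab hε hf hs hsb
    rw [rank_eq_card_basis B, Fintype.card_fin]
  · have := GKZ.subsingleton_ext ha hab hε hf hs hsb
    exact rank_subsingleton' ℂ _
  · exact GKZ.exists_basis ha hab hε ((family l hl).1 hβ) hs hsb
  · obtain ⟨q, hq, huniq, h⟩ := (family l hl).2 hβ
    refine ⟨q, hq, huniq, fun m₀ hm₀ => ?_⟩
    obtain ⟨B, hB⟩ := GKZ.exists_basis ha hab hε
      (modified l q m₀ (h m₀ hm₀).1 (h m₀ hm₀).2) hs hsb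
    refine ⟨B, fun k hk => ?_, ?_⟩
    · simpa only [if_neg hk] using hB k
    · simpa only [if_true] using hB q
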